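/- Let $V=\mathbb{C}^6$ with standard basis $e_1,\dots,e_6$, put $e_{ijk}=e_i\wedge e_j\wedge e_k$, and let $\mathrm{GL}(6)$ act on $\wedge^3V$ by $A\cdot(u\wedge v\wedge w)=Au\wedge Av\wedge Aw$. A nonzero vector (non-normalized state) $\psi\in\wedge^3V$ is called *separable*, *biseparable*, *of W type*, or *of GHZ type* if it lies in the $\mathrm{GL}(6)$-orbit of $e_{246}$, of $e_{235}+e_{246}$, of $e_{235}+e_{145}+e_{136}$, or of $e_{135}+e_{246}$, respectively. Write $\psi=\sum_{i<j<k}\xi_{ijk}e_{ijk}$ and extend $\xi_{ijk}$ antisymmetrically to all indices. Let $\wedge^3V\subset V\otimes V\otimes V$ via $v_1\wedge v_2\wedge v_3\mapsto \frac{1}{\sqrt{6}}\sum_{\sigma\in S_3}\mathrm{sgn}(\sigma)\,v_{\sigma(1)}\otimes v_{\sigma(2)}\otimes v_{\sigma(3)}$, let $\rho=|\psi\rangle\langle\psi|$, and let $\rho_{1,2}=\mathrm{tr}_3\,\rho$ and $\rho_1=\mathrm{tr}_{2,3}\,\rho$ be its partial traces. Put $$M_1=\|\psi\|^2=\sum_{i<j<k}|\xi_{ijk}|^2,\qquad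 M_2=\tfrac32\left(M_1^2-3\,\mathrm{tr}(\rho_1^2)\right),$$ $$M_3=3M_1(M_1^2-M_2)-27\,\mathrm{tr}\left(\rho_1\,\mathrm{tr}_2(\rho_{1,2}^2)\right),\qquad M_5=|F|^2,$$ where $F$ is the degree-$4$ relative $\mathrm{GL}(6)$-invariant of $\wedge^3V$, $F=\frac16\mathrm{tr}(K^2)$ with $K_{ij}=\frac1{12}\sum_{a,b,c,d,f}\varepsilon_{iabcdf}\,\xi_{jab}\,\xi_{cdf}$, where $\varepsilon$ is the Levi-Civita symbol (so that $F=d(4abc+dz^2)$ at $a e_{235}+b e_{145}+c e_{136}+d e_{246}+z e_{135}$). Then every nonzero $\psi\in\wedge^3V$ is (i) separable if and only if $M_2(\psi)=0$; (ii) biseparable if and only if $M_5(\psi)=0$, $M_1(\psi)M_2(\psi)-2M_3(\psi)=0$ and $M_2(\psi)>0$; (iii) of W type if and only if $M_5(\psi)=0$ and $M_1(\psi)M_2(\psi)-2M_3(\psi)>0$; (iv) of GHZ type if and only if $M_5(\psi)>0$. -/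

import Mathlib

noncomputable section

namespace ThreeFermion

/-- The single particle space `ℂ⁶`. -/
abbrev V : Type := Fin 6 → ℂ

/-- The space `∧³(ℂ⁶)` of three fermions with six single particle states. -/
abbrev Trivector : Type := ⋀[ℂ]^3 V

/-- The basis trivector `eᵢ ∧ eⱼ ∧ eₖ`, with indices in `{0, …, 5}`. -/
def e (i j k : Fin 6) : Trivector :=
  exteriorPower.ιMulti ℂ 3 ![Pi.single i 1, Pi.single j 1, Pi.single k 1]

/-- The coordinate `ξᵢⱼₖ` of `ψ`, for all `i, j, k` (antisymmetric in the indices):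
the value at `ψ` of `eᵢ* ∧ eⱼ* ∧ eₖ*`. For `i < j < k` it is the coefficient of `eᵢ ∧ eⱼ ∧ eₖ`. -/
def coeff (ψ : Trivector) (i j k : Fin 6) : ℂ :=
  exteriorPower.pairingDual ℂ V 3
    (exteriorPower.ιMulti ℂ 3
      ![LinearMap.proj (R := ℂ) (φ := fun _ : Fin 6 => ℂ) i, LinearMap.proj j, LinearMap.proj k]) ψ

/-! ### The action of `GL(6)` and the four nonzero orbits -/

/-- `φ` and `ψ` lie in the same `GL(6)`-orbit, `A` acting by
`A · (u ∧ v ∧ w) = Au ∧ Av ∧ Aw`. -/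
def GLEquivalent (φ ψ : Trivector) : Prop :=
  ∃ A : V ≃ₗ[ℂ] V, ψ = exteriorPower.map 3 (A : V →ₗ[ℂ] V) φ

/-- In the orbit of `e₂₄₆` (indices from `1`). -/
def IsSeparable (ψ : Trivector) : Prop := GLEquivalent (e 1 3 5) ψ

/-- In the orbit of `e₂₃₅ + e₂₄₆` (indices from `1`). -/
def IsBiseparable (ψ : Trivector) : Prop := GLEquivalent (e 1 2 4 + e 1 3 5) ψ

/-- In the orbit of `e₂₃₅ + e₁₄₅ + e₁₃₆` (indices from `1`). -/
def IsWType (ψ : Trivector) : Prop := GLEquivalent (e 1 2 4 + e 0 3 4 + e 0 2 5) ψ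

/-- In the orbit of `e₁₃₅ + e₂₄₆` (indices from `1`). -/
def IsGHZType (ψ : Trivector) : Prop := GLEquivalent (e 0 2 4 + e 1 3 5) ψ

/-! ### Reduced density matrices -/

/-- Components of the image of `ψ` under the isometric embedding `∧³(ℂ⁶) → ℂ⁶ ⊗ ℂ⁶ ⊗ ℂ⁶`,
`v₁ ∧ v₂ ∧ v₃ ↦ (1/√3!) ∑ σ, sgn σ • v_σ(1) ⊗ v_σ(2) ⊗ v_σ(3)`. -/
def tensor (ψ : Trivector) : (Fin 6 × Fin 6) × Fin 6 → ℂ :=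
  fun p => ((Real.sqrt 6)⁻¹ : ℂ) * coeff ψ p.1.1 p.1.2 p.2

/-- The density matrix `ρ = |ψ⟩⟨ψ|`, not normalized. -/
def rho (ψ : Trivector) : Matrix ((Fin 6 × Fin 6) × Fin 6) ((Fin 6 × Fin 6) × Fin 6) ℂ :=
  Matrix.vecMulVec (tensor ψ) (star (tensor ψ))

/-- The partial trace over the second tensor factor. -/
def ptraceSnd {m n : Type*} [Fintype n] (A : Matrix (m × n) (m × n) ℂ) : Matrix m m ℂ :=
  Matrix.of fun i i' => ∑ j, A (i, j) (i', j)

/-- `ρ₁₂ = tr₃ ρ`. -/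
def rho12 (ψ : Trivector) : Matrix (Fin 6 × Fin 6) (Fin 6 × Fin 6) ℂ := ptraceSnd (rho ψ)

/-- `ρ₁ = tr₂₃ ρ`. -/
def rho1 (ψ : Trivector) : Matrix (Fin 6) (Fin 6) ℂ := ptraceSnd (rho12 ψ)

/-! ### The relative invariant of `∧³(ℂ⁶)` -/

/-- The quadratic covariant `K_ψ : V → V ⊗ ∧⁶V*` in coordinates,
`(K_ψ)ᵢⱼ = (1/12) ∑ ε(i,a,b,c,d,f) ξ(j,a,b) ξ(c,d,f)`. -/
def K (ψ : Trivector) : Matrix (Fin 6) (Fin 6) ℂ :=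
  Matrix.of fun i j => (1 / 12 : ℂ) *
    ∑ σ : Equiv.Perm (Fin 6), if σ 0 = i then
      ((Equiv.Perm.sign σ : ℤ) : ℂ) * coeff ψ j (σ 1) (σ 2) * coeff ψ (σ 3) (σ 4) (σ 5) else 0

/-- The relative invariant of degree 4 of the prehomogeneous space `∧³(ℂ⁶)`, `F = tr(K²)/6`.
Its value at `a e₂₃₅ + b e₁₄₅ + c e₁₃₆ + d e₂₄₆ + z e₁₃₅` is `d(4abc + dz²)`. -/
def F (ψ : Trivector) : ℂ := (1 / 6 : ℂ) * (K ψ * K ψ).trace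

/-! ### The unitary invariants. The traces below are real; `.re` only changes their type. -/

/-- `M₁ = ‖ψ‖² = ∑_{i<j<k} |ξᵢⱼₖ|²`. -/
def M₁ (ψ : Trivector) : ℝ :=
  ∑ i : Fin 6, ∑ j : Fin 6, ∑ k : Fin 6, if i < j ∧ j < k then ‖coeff ψ i j k‖ ^ 2 else 0

/-- `M₂ = (3/2)(M₁² - 3 tr(ρ₁²))`. -/
def M₂ (ψ : Trivector) : ℝ := 3 / 2 * (M₁ ψ ^ 2 - 3 * (rho1 ψ ^ 2).trace.re)

/-- `M₃ = 3M₁(M₁² - M₂) - 27 tr(ρ₁ tr₂(ρ₁₂²))`. -/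
def M₃ (ψ : Trivector) : ℝ :=
  3 * M₁ ψ * (M₁ ψ ^ 2 - M₂ ψ) - 27 * (rho1 ψ * ptraceSnd (rho12 ψ ^ 2)).trace.re

/-- `M₅ = |F|²`. -/
def M₅ (ψ : Trivector) : ℝ := ‖F ψ‖ ^ 2

end ThreeFermion

end

noncomputable section

namespace ThreeFermion

open Matrix

/-! The group `U(6)` preserves `M₁`, `M₂`, `M₃`, and it carries every nonzero trivector to a normal
form `d e₁₃₅ + a e₁₂₄ + b e₀₃₄ + c e₀₂₅ + z e₀₂₄` (indices from 0) with `d ≠ 0`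
(`exists_unitary_normalForm`). To find it, rotate so that the coordinate 135 has maximal modulus.
Maximality kills the coordinates with exactly one even index, and a singular value decomposition
diagonalizes the 3 × 3 block of coordinates with exactly two.

The normal form is a three-qubit state on the planes `⟨e₀,e₁⟩`, `⟨e₂,e₃⟩`, `⟨e₄,e₅⟩`, and its orbit
is read off from `d(4abc + dz²)`, Cayley's hyperdeterminant here. If this is nonzero, the type is
GHZ. If it is zero, then either `z ≠ 0` and `abc ≠ 0`, which gives W, or `z = 0` and the number of
nonzero entries among `a, b, c` (0, 1 or 2) gives separable, biseparable or W. On the normal form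
`M₂` and `M₁M₂ - 2M₃` are sums of nonnegative terms, so their signs are visible in each case
(`normalForm_classification`).

This assigns at least one type to each `ψ`. That the types exclude each other follows from two
`GL(6)`-invariants: the vanishing of `F`, which is multiplied by `det²` (`F_matMap`), singles out
GHZ, and the rank of the Gram matrix, equal to 3, 5, 6 on the other orbits, separates these. -/

/-! ### Coordinates and the matrix action -/

/-- Coordinate arrays of elements of `V ⊗ V ⊗ V`. -/
abbrev Array3 : Type := Fin 6 → Fin 6 → Fin 6 → ℂ

/-- The action of a matrix on all three indices of an array. -/
def act (A : Matrix (Fin 6) (Fin 6) ℂ) (ξ : Array3) : Array3 := fun i j k =>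
  ∑ a, ∑ b, ∑ c, A i a * A j b * A k c * ξ a b c

/-- Antisymmetric arrays. -/
structure IsAlt (ξ : Array3) : Prop where
  swap₁₂ : ∀ i j k, ξ j i k = -ξ i j k
  swap₂₃ : ∀ i j k, ξ i k j = -ξ i j k

lemma coeff_ιMulti (v : Fin 3 → V) (i j k : Fin 6) :
    coeff (exteriorPower.ιMulti ℂ 3 v) i j k =
      v 0 i * v 1 j * v 2 k - v 0 i * v 2 j * v 1 k - v 1 i * v 0 j * v 2 k
        + v 1 i * v 2 j * v 0 k + v 2 i * v 0 j * v 1 k - v 2 i * v 1 j * v 0 k := by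
  rw [coeff, exteriorPower.pairingDual_ιMulti_ιMulti, det_fin_three]
  simp
  ring

/-- The coordinate functions as linear forms. -/
def coeffLinear (i j k : Fin 6) : Trivector →ₗ[ℂ] ℂ :=
  exteriorPower.pairingDual ℂ V 3
    (exteriorPower.ιMulti ℂ 3
      ![LinearMap.proj (R := ℂ) (φ := fun _ : Fin 6 => ℂ) i, LinearMap.proj j, LinearMap.proj k])

lemma coeffLinear_apply (i j k : Fin 6) (ψ : Trivector) : coeffLinear i j k ψ = coeff ψ i j k :=
  rfl

lemma coeff_add (φ ψ : Trivector) (i j k : Fin 6) :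
    coeff (φ + ψ) i j k = coeff φ i j k + coeff ψ i j k :=
  map_add (coeffLinear i j k) φ ψ

lemma coeff_smul (c : ℂ) (ψ : Trivector) (i j k : Fin 6) :
    coeff (c • ψ) i j k = c * coeff ψ i j k :=
  map_smul (coeffLinear i j k) c ψ

lemma isAlt_coeff (ψ : Trivector) : IsAlt (coeff ψ) := by
  constructor <;> intro i j k <;> simp only [← coeffLinear_apply]
  · have : coeffLinear j i k = -coeffLinear i j k := by
      refine exteriorPower.linearMap_ext (AlternatingMap.ext fun v => ?_)
      simp only [LinearMap.compAlternatingMap_apply, LinearMap.neg_apply, coeffLinear_apply,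
        coeff_ιMulti]
      ring
    rw [this, LinearMap.neg_apply]
  · have : coeffLinear i k j = -coeffLinear i j k := by
      refine exteriorPower.linearMap_ext (AlternatingMap.ext fun v => ?_)
      simp only [LinearMap.compAlternatingMap_apply, LinearMap.neg_apply, coeffLinear_apply,
        coeff_ιMulti]
      ring
    rw [this, LinearMap.neg_apply]

/-- Each of the six terms of `coeff_ιMulti` has this shape, so covariance of the coordinates can be
checked term by term on decomposable trivectors. -/
lemma act_triple (A : Matrix (Fin 6) (Fin 6) ℂ) (u v w : V) (i j k : Fin 6) :
    ∑ a, ∑ b, ∑ c, A i a * A j b * A k c * (u a * v b * w c) =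
      (A *ᵥ u) i * (A *ᵥ v) j * (A *ᵥ w) k := by
  simp only [mulVec, dotProduct]
  rw [Finset.sum_mul_sum, Finset.sum_mul]
  refine Finset.sum_congr rfl fun a _ => ?_
  rw [Finset.sum_mul]
  refine Finset.sum_congr rfl fun b _ => ?_
  rw [Finset.mul_sum]
  exact Finset.sum_congr rfl fun c _ => by ring

lemma coeff_map (f : V →ₗ[ℂ] V) (ψ : Trivector) :
    coeff (exteriorPower.map 3 f ψ) = act (LinearMap.toMatrix' f) (coeff ψ) := by
  funext i j k
  let g : Trivector →ₗ[ℂ] ℂ := ∑ a, ∑ b, ∑ c, (LinearMap.toMatrix' f i a * LinearMap.toMatrix' f j b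
    * LinearMap.toMatrix' f k c) • coeffLinear a b c
  have hg : coeffLinear i j k ∘ₗ exteriorPower.map 3 f = g := by
    refine exteriorPower.linearMap_ext (AlternatingMap.ext fun v => ?_)
    simp only [g, LinearMap.compAlternatingMap_apply, LinearMap.comp_apply,
      exteriorPower.map_apply_ιMulti, LinearMap.sum_apply, LinearMap.smul_apply, coeffLinear_apply,
      coeff_ιMulti, smul_eq_mul, mul_add, mul_sub, Finset.sum_add_distrib, Finset.sum_sub_distrib,
      act_triple, LinearMap.toMatrix'_mulVec, Function.comp_apply]
  have := LinearMap.congr_fun hg ψ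
  simp only [g, LinearMap.comp_apply, LinearMap.sum_apply, LinearMap.smul_apply, smul_eq_mul,
    coeffLinear_apply] at this
  exact this

/-- The dual basis of `∧³V` consists of coordinate functions, taken at the increasing enumerations
of the 3-subsets. -/
lemma coeff_injective : Function.Injective coeff := by
  intro φ ψ h
  let b := Pi.basisFun ℂ (Fin 6)
  refine (b.exteriorPower 3).repr.injective (Finsupp.ext fun s => ?_)
  rw [exteriorPower.basis_repr_apply, exteriorPower.basis_repr_apply]
  have key : exteriorPower.ιMultiDual ℂ 3 b s =
      coeffLinear (Set.powersetCard.ofFinEmbEquiv.symm s 0)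
        (Set.powersetCard.ofFinEmbEquiv.symm s 1) (Set.powersetCard.ofFinEmbEquiv.symm s 2) := by
    rw [exteriorPower.ιMultiDual, exteriorPower.ιMulti_family, coeffLinear]
    congr 2
  rw [key, coeffLinear_apply, coeffLinear_apply, h]

namespace IsAlt

variable {ξ η : Array3}

lemma self₁₂ (h : IsAlt ξ) (i k : Fin 6) : ξ i i k = 0 := by
  have := h.swap₁₂ i i k
  linear_combination this / 2

lemma self₂₃ (h : IsAlt ξ) (i k : Fin 6) : ξ i k k = 0 := by
  have := h.swap₂₃ i k k
  linear_combination this / 2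

lemma self₁₃ (h : IsAlt ξ) (i k : Fin 6) : ξ i k i = 0 := by
  rw [h.swap₂₃, h.self₁₂, neg_zero]

lemma cycle (h : IsAlt ξ) (i j k : Fin 6) : ξ j k i = ξ i j k := by
  rw [h.swap₂₃, h.swap₁₂, neg_neg]

lemma sub (h : IsAlt ξ) (h' : IsAlt η) : IsAlt (ξ - η) :=
  ⟨fun i j k => by simp only [Pi.sub_apply, h.swap₁₂ i j k, h'.swap₁₂ i j k]; ring,
   fun i j k => by simp only [Pi.sub_apply, h.swap₂₃ i j k, h'.swap₂₃ i j k]; ring⟩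

lemma eq_zero (h : IsAlt ξ) (h0 : ∀ i j k, i < j → j < k → ξ i j k = 0) : ξ = 0 := by
  have h1 : ∀ i j k, i < j → ξ i j k = 0 := by
    intro i j k hij
    rcases lt_trichotomy j k with hjk | rfl | hjk
    · exact h0 i j k hij hjk
    · exact h.self₂₃ _ _
    · rcases lt_trichotomy i k with hik | rfl | hik
      · rw [h.swap₂₃, h0 i k j hik hjk, neg_zero]
      · exact h.self₁₃ _ _
      · rw [h.cycle, h0 k i j hik hij]
  funext i j k
  rcases lt_trichotomy i j with hij | rfl | hij
  · exact h1 i j k hij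
  · exact h.self₁₂ _ _
  · rw [h.swap₁₂, h1 j i k hij, neg_zero]; rfl

lemma ext (h : IsAlt ξ) (h' : IsAlt η) (h0 : ∀ i j k, i < j → j < k → ξ i j k = η i j k) :
    ξ = η :=
  sub_eq_zero.mp <| (h.sub h').eq_zero fun i j k hij hjk => sub_eq_zero.mpr (h0 i j k hij hjk)

end IsAlt

/-- Functoriality of the exterior power replaces a manipulation of sixfold sums. -/
lemma act_act (A B : Matrix (Fin 6) (Fin 6) ℂ) (ψ : Trivector) :
    act A (act B (coeff ψ)) = act (A * B) (coeff ψ) := by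
  have hA := coeff_map (Matrix.toLin' A) (exteriorPower.map 3 (Matrix.toLin' B) ψ)
  rw [coeff_map (Matrix.toLin' B), LinearMap.toMatrix'_toLin', LinearMap.toMatrix'_toLin'] at hA
  rw [← hA, ← LinearMap.comp_apply, ← exteriorPower.map_comp, ← Matrix.toLin'_mul, coeff_map,
    LinearMap.toMatrix'_toLin']

lemma act_one (ψ : Trivector) : act 1 (coeff ψ) = coeff ψ := by
  have h := coeff_map LinearMap.id ψ
  rwa [exteriorPower.map_id, LinearMap.toMatrix'_id, LinearMap.id_apply, eq_comm] at h

/-- `A · ψ` for a matrix `A`. -/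
def matMap (A : Matrix (Fin 6) (Fin 6) ℂ) : Trivector →ₗ[ℂ] Trivector :=
  exteriorPower.map 3 (Matrix.toLin' A)

lemma coeff_matMap (A : Matrix (Fin 6) (Fin 6) ℂ) (ψ : Trivector) :
    coeff (matMap A ψ) = act A (coeff ψ) := by
  rw [matMap, coeff_map, LinearMap.toMatrix'_toLin']

lemma matMap_matMap (A B : Matrix (Fin 6) (Fin 6) ℂ) (ψ : Trivector) :
    matMap A (matMap B ψ) = matMap (A * B) ψ :=
  coeff_injective (by rw [coeff_matMap, coeff_matMap, coeff_matMap, act_act])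

lemma matMap_one (ψ : Trivector) : matMap 1 ψ = ψ :=
  coeff_injective (by rw [coeff_matMap, act_one])

lemma matMap_ιMulti (A : Matrix (Fin 6) (Fin 6) ℂ) (v : Fin 3 → V) :
    matMap A (exteriorPower.ιMulti ℂ 3 v) = exteriorPower.ιMulti ℂ 3 fun m => A *ᵥ v m := by
  rw [matMap, exteriorPower.map_apply_ιMulti]
  rfl

lemma gLEquivalent_iff {φ ψ : Trivector} :
    GLEquivalent φ ψ ↔ ∃ A : Matrix (Fin 6) (Fin 6) ℂ, A.det ≠ 0 ∧ ψ = matMap A φ := by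
  constructor
  · rintro ⟨A, rfl⟩
    refine ⟨LinearMap.toMatrix' (A : V →ₗ[ℂ] V), ?_, by rw [matMap, Matrix.toLin'_toMatrix']⟩
    rw [LinearMap.det_toMatrix']
    exact (LinearEquiv.isUnit_det' A).ne_zero
  · rintro ⟨A, hA, rfl⟩
    have hu : IsUnit A.det := hA.isUnit
    refine ⟨Matrix.toLin'OfInv (A.nonsing_inv_mul hu) (A.mul_nonsing_inv hu), ?_⟩
    rw [matMap]
    congr 2

lemma GLEquivalent.symm {φ ψ : Trivector} (h : GLEquivalent φ ψ) : GLEquivalent ψ φ := by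
  obtain ⟨A, hA, rfl⟩ := gLEquivalent_iff.mp h
  refine gLEquivalent_iff.mpr ⟨A⁻¹, ?_, ?_⟩
  · rw [Matrix.det_nonsing_inv]; simpa using hA
  · rw [matMap_matMap, A.nonsing_inv_mul hA.isUnit, matMap_one]

lemma GLEquivalent.trans {φ ψ χ : Trivector} (h : GLEquivalent φ ψ) (h' : GLEquivalent ψ χ) :
    GLEquivalent φ χ := by
  obtain ⟨A, hA, rfl⟩ := gLEquivalent_iff.mp h
  obtain ⟨B, hB, rfl⟩ := gLEquivalent_iff.mp h'
  refine gLEquivalent_iff.mpr ⟨B * A, ?_, by rw [matMap_matMap]⟩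
  rw [Matrix.det_mul]
  exact mul_ne_zero hB hA

/-! ### Covariance of the relative invariant -/

/-- The coordinates of a basis trivector, as integers. -/
def basisCoeff (a b c i j k : Fin 6) : ℤ :=
  let δ (x y : Fin 6) : ℤ := if y = x then 1 else 0
  δ a i * δ b j * δ c k - δ a i * δ c j * δ b k - δ b i * δ a j * δ c k
    + δ b i * δ c j * δ a k + δ c i * δ a j * δ b k - δ c i * δ b j * δ a k

lemma coeff_e (a b c i j k : Fin 6) : coeff (e a b c) i j k = (basisCoeff a b c i j k : ℂ) := by
  rw [e, coeff_ιMulti]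
  simp [basisCoeff, Pi.single_apply]

-- Integer coordinates make the sum over the 720 permutations decidable by evaluation, for each of
-- the 36 entries.
set_option maxRecDepth 100000 in
lemma sum_perm_basisCoeff_GHZ (i j : Fin 6) :
    (∑ σ : Equiv.Perm (Fin 6), if σ 0 = i then (Equiv.Perm.sign σ : ℤ) *
      (basisCoeff 0 2 4 j (σ 1) (σ 2) + basisCoeff 1 3 5 j (σ 1) (σ 2)) *
      (basisCoeff 0 2 4 (σ 3) (σ 4) (σ 5) + basisCoeff 1 3 5 (σ 3) (σ 4) (σ 5)) else 0) =
    if i = j then (if i = 0 ∨ i = 2 ∨ i = 4 then -12 else 12) else 0 := by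
  revert i j
  decide +kernel

lemma K_GHZ : K (e 0 2 4 + e 1 3 5) =
    diagonal fun i => if i = 0 ∨ i = 2 ∨ i = 4 then (-1 : ℂ) else 1 := by
  ext i j
  have h := congrArg (Int.cast : ℤ → ℂ) (sum_perm_basisCoeff_GHZ i j)
  simp only [Int.cast_sum, apply_ite (Int.cast : ℤ → ℂ), Int.cast_mul, Int.cast_add, Int.cast_zero,
    Int.cast_neg, Int.cast_ofNat] at h
  simp only [K, of_apply, coeff_add, coeff_e, h, diagonal_apply]
  split_ifs <;> norm_num

lemma F_GHZ : F (e 0 2 4 + e 1 3 5) = 1 := by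
  rw [F, K_GHZ, diagonal_mul_diagonal, trace_diagonal]
  have h (i : Fin 6) : (if i = 0 ∨ i = 2 ∨ i = 4 then (-1 : ℂ) else 1) *
      (if i = 0 ∨ i = 2 ∨ i = 4 then (-1 : ℂ) else 1) = 1 := by
    split_ifs <;> norm_num
  simp [h]

lemma act_eq_sum_prod (A : Matrix (Fin 6) (Fin 6) ℂ) (ξ : Array3) (i j k : Fin 6) :
    act A ξ i j k =
      ∑ x : Fin 6 × Fin 6 × Fin 6, A i x.1 * A j x.2.1 * A k x.2.2 * ξ x.1 x.2.1 x.2.2 := by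
  simp only [Fintype.sum_prod_type, act]

/-- Contracting all six indices of the Levi-Civita symbol with `A` multiplies it by `det A`. The
last factor is the symbol at `y`, which vanishes when `y` repeats a value. -/
lemma sum_sign_mul_prod (A : Matrix (Fin 6) (Fin 6) ℂ) (y : Fin 6 → Fin 6) :
    ∑ σ : Equiv.Perm (Fin 6), ((Equiv.Perm.sign σ : ℤ) : ℂ) * ∏ m, A (σ m) (y m) =
      A.det * ((1 : Matrix (Fin 6) (Fin 6) ℂ).submatrix id y).det := by
  rw [← det_mul]
  have : A * (1 : Matrix (Fin 6) (Fin 6) ℂ).submatrix id y = A.submatrix id y := by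
    ext i j
    simp [mul_apply, one_apply]
  rw [this, det_apply']
  rfl

/-- The contraction of the Levi-Civita symbol with two copies of an array. -/
def leviCivitaContraction (ξ : Array3) : Matrix (Fin 6) (Fin 6) ℂ := of fun p j => (1 / 12 : ℂ) *
  ∑ u : Fin 6 × Fin 6, ∑ x : Fin 6 × Fin 6 × Fin 6,
    ξ j u.1 u.2 * ξ x.1 x.2.1 x.2.2 *
      ((1 : Matrix (Fin 6) (Fin 6) ℂ).submatrix id ![p, u.1, u.2, x.1, x.2.1, x.2.2]).det

/-- Multiplication by `Aᵀ` contracts the one index of the Levi-Civita symbol that carries no `A` in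
`K (matMap A ψ)`; then `sum_sign_mul_prod` applies to all six. -/
lemma transpose_mul_K_matMap_aux (A : Matrix (Fin 6) (Fin 6) ℂ) (ψ : Trivector) :
    Aᵀ * K (matMap A ψ) = A.det • (leviCivitaContraction (coeff ψ) * Aᵀ) := by
  ext p j
  have h1 : (Aᵀ * K (matMap A ψ)) p j = (1 / 12 : ℂ) * ∑ σ : Equiv.Perm (Fin 6),
      A (σ 0) p * (((Equiv.Perm.sign σ : ℤ) : ℂ) * act A (coeff ψ) j (σ 1) (σ 2) *
        act A (coeff ψ) (σ 3) (σ 4) (σ 5)) := by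
    simp only [mul_apply, transpose_apply, K, of_apply, coeff_matMap, Finset.mul_sum]
    rw [Finset.sum_comm]
    refine Finset.sum_congr rfl fun σ _ => ?_
    rw [Finset.sum_eq_single (σ 0)]
    · rw [if_pos rfl]; ring
    · intro i _ hi
      rw [if_neg (Ne.symm hi)]; ring
    · simp
  rw [h1, Matrix.smul_apply, mul_apply, smul_eq_mul]
  simp only [act_eq_sum_prod, leviCivitaContraction, of_apply, transpose_apply]
  have h2 : ∀ σ : Equiv.Perm (Fin 6), A (σ 0) p * (((Equiv.Perm.sign σ : ℤ) : ℂ) *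
      (∑ x : Fin 6 × Fin 6 × Fin 6,
        A j x.1 * A (σ 1) x.2.1 * A (σ 2) x.2.2 * coeff ψ x.1 x.2.1 x.2.2) *
      ∑ x : Fin 6 × Fin 6 × Fin 6,
        A (σ 3) x.1 * A (σ 4) x.2.1 * A (σ 5) x.2.2 * coeff ψ x.1 x.2.1 x.2.2) =
      ∑ y : Fin 6 × Fin 6 × Fin 6, ∑ x : Fin 6 × Fin 6 × Fin 6,
        A j y.1 * coeff ψ y.1 y.2.1 y.2.2 * coeff ψ x.1 x.2.1 x.2.2 *
        (((Equiv.Perm.sign σ : ℤ) : ℂ) *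
          ∏ m, A (σ m) (![p, y.2.1, y.2.2, x.1, x.2.1, x.2.2] m)) := by
    intro σ
    rw [mul_assoc _ (Finset.sum _ _) (Finset.sum _ _), Finset.sum_mul_sum, Finset.mul_sum,
      Finset.mul_sum]
    refine Finset.sum_congr rfl fun y _ => ?_
    rw [Finset.mul_sum, Finset.mul_sum]
    refine Finset.sum_congr rfl fun x _ => ?_
    rw [Fin.prod_univ_six]
    simp only [cons_val]
    ring
  rw [Finset.sum_congr rfl fun σ _ => h2 σ, Finset.sum_comm, Fintype.sum_prod_type, Finset.mul_sum,
    Finset.mul_sum]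
  refine Finset.sum_congr rfl fun q _ => ?_
  rw [Finset.mul_sum, Finset.mul_sum, Finset.sum_mul, Finset.mul_sum]
  refine Finset.sum_congr rfl fun u _ => ?_
  rw [Finset.sum_comm, Finset.mul_sum, Finset.mul_sum, Finset.sum_mul, Finset.mul_sum]
  refine Finset.sum_congr rfl fun x _ => ?_
  rw [← Finset.mul_sum, sum_sign_mul_prod]
  ring

lemma transpose_mul_K_matMap (A : Matrix (Fin 6) (Fin 6) ℂ) (ψ : Trivector) :
    Aᵀ * K (matMap A ψ) = A.det • (K ψ * Aᵀ) := by
  -- The case `A = 1` identifies the contraction with `K ψ` itself.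
  have h := transpose_mul_K_matMap_aux 1 ψ
  rw [matMap_one, transpose_one, one_mul, mul_one, det_one, one_smul] at h
  rw [transpose_mul_K_matMap_aux, h]

/-- `K` changes by a conjugation and the factor `det A`, so the trace of its square changes by `det
A ^ 2`. -/
lemma F_matMap {A : Matrix (Fin 6) (Fin 6) ℂ} (hA : A.det ≠ 0) (ψ : Trivector) :
    F (matMap A ψ) = A.det ^ 2 * F ψ := by
  have hu : IsUnit Aᵀ.det := by rw [det_transpose]; exact hA.isUnit
  have h : K (matMap A ψ) = A.det • (Aᵀ⁻¹ * K ψ * Aᵀ) := by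
    rw [mul_assoc, ← mul_smul_comm, ← transpose_mul_K_matMap, ← mul_assoc, nonsing_inv_mul _ hu,
      one_mul]
  have h2 : Aᵀ⁻¹ * K ψ * Aᵀ * (Aᵀ⁻¹ * K ψ * Aᵀ) = Aᵀ⁻¹ * (K ψ * K ψ * Aᵀ) := by
    simp only [mul_assoc, mul_nonsing_inv_cancel_left _ _ hu]
  rw [F, F, h, smul_mul_smul_comm, h2, trace_smul, trace_mul_comm, mul_assoc, mul_nonsing_inv _ hu,
    mul_one, smul_eq_mul]
  ring

lemma F_eq_zero_iff_of_gLEquivalent {φ ψ : Trivector} (h : GLEquivalent φ ψ) :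
    F ψ = 0 ↔ F φ = 0 := by
  obtain ⟨A, hA, rfl⟩ := gLEquivalent_iff.mp h
  rw [F_matMap hA, mul_eq_zero, or_iff_right (pow_ne_zero 2 hA)]

lemma matMap_diagonal_e (t : Fin 6 → ℂ) (i j k : Fin 6) :
    matMap (diagonal t) (e i j k) = (t i * t j * t k) • e i j k := by
  refine coeff_injective (funext fun a => funext fun b => funext fun c => ?_)
  have hs (i : Fin 6) : diagonal t *ᵥ (Pi.single i 1 : V) = fun a => t i * (Pi.single i 1 : V) a := by
    ext a
    rw [mulVec_diagonal, Pi.single_apply]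
    split_ifs with h <;> simp [h]
  rw [coeff_smul, e, matMap_ιMulti, coeff_ιMulti, coeff_ιMulti]
  simp only [cons_val, hs]
  ring

/-- A stabilizer element whose determinant is not ±1 forces a relative invariant of weight `det²` to
vanish. -/
lemma F_eq_zero_of_fixed {t : Fin 6 → ℂ} {ψ : Trivector} (h : matMap (diagonal t) ψ = ψ)
    (h0 : ∏ i, t i ≠ 0) (h1 : (∏ i, t i) ^ 2 ≠ 1) : F ψ = 0 := by
  have hF := F_matMap (A := diagonal t) (by rwa [det_diagonal]) ψ
  rw [h, det_diagonal] at hF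
  by_contra hne
  exact h1 (mul_right_cancel₀ hne (by rw [← hF, one_mul]))

lemma F_W : F (e 1 2 4 + e 0 3 4 + e 0 2 5) = 0 := by
  -- Each term has two even indices and one odd, hence weight 2 · 2 · 1/4 = 1, while the determinant
  -- is 1/8.
  refine F_eq_zero_of_fixed (t := ![2, 1 / 4, 2, 1 / 4, 2, 1 / 4]) ?_ ?_ ?_
  · simp only [map_add, matMap_diagonal_e, cons_val]
    norm_num
  · simp [Fin.prod_univ_six]
  · rw [Fin.prod_univ_six]
    simp only [cons_val]
    norm_num

lemma F_biseparable : F (e 1 2 4 + e 1 3 5) = 0 := by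
  refine F_eq_zero_of_fixed (t := ![2, 1, 1, 1, 1, 1]) ?_ ?_ ?_
  · simp only [map_add, matMap_diagonal_e, cons_val]
    norm_num
  · simp [Fin.prod_univ_six]
  · rw [Fin.prod_univ_six]
    simp only [cons_val]
    norm_num

lemma F_separable : F (e 1 3 5) = 0 := by
  refine F_eq_zero_of_fixed (t := ![2, 1, 1, 1, 1, 1]) ?_ ?_ ?_
  · simp only [matMap_diagonal_e, cons_val]
    norm_num
  · simp [Fin.prod_univ_six]
  · rw [Fin.prod_univ_six]
    simp only [cons_val]
    norm_num

/-! ### Unitary invariance -/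

section UnitaryInvariance

open scoped Kronecker ComplexOrder

/-- The flattening of an array along its first index. -/
def flatten (ξ : Array3) : Matrix (Fin 6) (Fin 6 × Fin 6) ℂ := of fun i p => ξ i p.1 p.2

/-- The Gram matrix `∑ⱼₖ ξᵢⱼₖ ξ̄ᵢ'ⱼₖ`. -/
def gram (ξ : Array3) : Matrix (Fin 6) (Fin 6) ℂ := flatten ξ * (flatten ξ)ᴴ

/-- The Gram matrix of an array weighted with its own Gram matrix. -/
def weightedGram (ξ : Array3) : Matrix (Fin 6) (Fin 6) ℂ :=
  flatten ξ * ((1 : Matrix (Fin 6) (Fin 6) ℂ) ⊗ₖ (gram ξ)ᵀ) * (flatten ξ)ᴴ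

lemma gram_apply (ξ : Array3) (i i' : Fin 6) :
    gram ξ i i' = ∑ j, ∑ k, ξ i j k * star (ξ i' j k) := by
  simp only [gram, mul_apply, flatten, of_apply, conjTranspose_apply, Fintype.sum_prod_type]

lemma weightedGram_apply (ξ : Array3) (i i' : Fin 6) :
    weightedGram ξ i i' =
      ∑ j, ∑ k', (∑ k, ξ i j k * gram ξ k' k) * star (ξ i' j k') := by
  simp only [weightedGram, mul_apply, flatten, of_apply, conjTranspose_apply,
    Fintype.sum_prod_type, kroneckerMap_apply, one_apply, transpose_apply]
  simp

lemma inv_sqrt_six_mul_self : ((Real.sqrt 6 : ℂ)⁻¹) * star ((Real.sqrt 6 : ℂ)⁻¹) = 1 / 6 := by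
  have h : (Real.sqrt 6 : ℂ) * Real.sqrt 6 = 6 := by
    rw [← Complex.ofReal_mul, Real.mul_self_sqrt (by norm_num)]; norm_num
  rw [star_inv₀, Complex.star_def, Complex.conj_ofReal, ← mul_inv, h, one_div]

lemma rho12_apply (ψ : Trivector) (p q : Fin 6 × Fin 6) :
    rho12 ψ p q = 1 / 6 * ∑ k, coeff ψ p.1 p.2 k * star (coeff ψ q.1 q.2 k) := by
  simp only [rho12, ptraceSnd, of_apply, rho, vecMulVec_apply, Pi.star_apply, tensor, star_mul',
    Finset.mul_sum, ← inv_sqrt_six_mul_self]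
  exact Finset.sum_congr rfl fun k _ => by ring

lemma rho1_eq (ψ : Trivector) : rho1 ψ = (1 / 6 : ℂ) • gram (coeff ψ) := by
  ext i i'
  simp only [rho1, ptraceSnd, of_apply, rho12_apply, Matrix.smul_apply, gram_apply, smul_eq_mul,
    Finset.mul_sum]

/-- The square of `ρ₁₂` contracts the first two slots; antisymmetry turns this into the contraction
of the last two that defines `gram`. -/
lemma IsAlt.gram_eq {ξ : Array3} (h : IsAlt ξ) (k k' : Fin 6) :
    gram ξ k' k = ∑ p : Fin 6 × Fin 6, star (ξ p.1 p.2 k) * ξ p.1 p.2 k' := by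
  simp only [gram_apply, Fintype.sum_prod_type]
  refine Finset.sum_congr rfl fun i _ => Finset.sum_congr rfl fun j _ => ?_
  rw [← h.cycle k i j, ← h.cycle k' i j, mul_comm]

lemma ptraceSnd_rho12_sq (ψ : Trivector) :
    ptraceSnd (rho12 ψ ^ 2) = (1 / 36 : ℂ) • weightedGram (coeff ψ) := by
  ext i i'
  simp only [ptraceSnd, of_apply, sq, mul_apply, rho12_apply, Matrix.smul_apply,
    weightedGram_apply, smul_eq_mul, (isAlt_coeff ψ).gram_eq]
  rw [Finset.mul_sum]
  refine Finset.sum_congr rfl fun j _ => ?_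
  have h1 : ∀ q : Fin 6 × Fin 6, (1 / 6 * ∑ k, coeff ψ i j k * star (coeff ψ q.1 q.2 k)) *
      (1 / 6 * ∑ k', coeff ψ q.1 q.2 k' * star (coeff ψ i' j k')) =
      1 / 36 * ∑ k', ∑ k, coeff ψ i j k * (star (coeff ψ q.1 q.2 k) * coeff ψ q.1 q.2 k') *
        star (coeff ψ i' j k') := by
    intro q
    rw [mul_mul_mul_comm, Finset.sum_mul_sum, Finset.sum_comm]
    norm_num
    exact Finset.sum_congr rfl fun k' _ => Finset.sum_congr rfl fun k _ => by ring
  rw [Finset.sum_congr rfl fun q _ => h1 q, ← Finset.mul_sum, Finset.sum_comm]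
  congr 1
  refine Finset.sum_congr rfl fun k' _ => ?_
  rw [Finset.sum_comm, Finset.sum_mul]
  refine Finset.sum_congr rfl fun k _ => ?_
  rw [Finset.mul_sum, Finset.sum_mul]

/-- A symmetric function vanishing on repeated indices takes each value once per ordering of the
index set. -/
lemma sum_eq_six_mul_sum_ordered {g : Fin 6 → Fin 6 → Fin 6 → ℝ} (h₁ : ∀ i j k, g j i k = g i j k)
    (h₂ : ∀ i j k, g i k j = g i j k) (h₀ : ∀ i j, g i i j = 0) :
    ∑ i, ∑ j, ∑ k, g i j k = 6 * ∑ i, ∑ j, ∑ k, if i < j ∧ j < k then g i j k else 0 := by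
  have key : ∀ i j k, g i j k = (if i < j ∧ j < k then g i j k else 0) +
      (if i < k ∧ k < j then g i k j else 0) + (if j < i ∧ i < k then g j i k else 0) +
      (if j < k ∧ k < i then g j k i else 0) + (if k < i ∧ i < j then g k i j else 0) +
      (if k < j ∧ j < i then g k j i else 0) := by
    intro i j k
    have e1 : g i k j = g i j k := h₂ _ _ _
    have e2 : g j i k = g i j k := h₁ _ _ _
    have e3 : g j k i = g i j k := by rw [h₂, h₁]
    have e4 : g k i j = g i j k := by rw [h₁, h₂]
    have e5 : g k j i = g i j k := by rw [h₁, e3]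
    rw [e1, e2, e3, e4, e5]
    by_cases hz : i = j ∨ j = k ∨ i = k
    · have : g i j k = 0 := by
        rcases hz with rfl | rfl | rfl
        · exact h₀ _ _
        · rw [← e3]; exact h₀ _ _
        · rw [← e1]; exact h₀ _ _
      simp [this]
    · push Not at hz
      rcases lt_or_gt_of_ne hz.1 with h | h <;> rcases lt_or_gt_of_ne hz.2.1 with h' | h' <;>
        rcases lt_or_gt_of_ne hz.2.2 with h'' | h'' <;>
        first
        | (exfalso; omega)
        | simp [h, h', h'', not_lt_of_gt h, not_lt_of_gt h', not_lt_of_gt h'']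
  rw [Finset.sum_congr rfl fun i _ => Finset.sum_congr rfl fun j _ => Finset.sum_congr rfl
    fun k _ => key i j k]
  simp only [Finset.sum_add_distrib]
  set S := ∑ i, ∑ j, ∑ k, if i < j ∧ j < k then g i j k else 0 with hS
  have s2 : ∑ i, ∑ j, ∑ k, (if i < k ∧ k < j then g i k j else 0) = S :=
    Finset.sum_congr rfl fun i _ => Finset.sum_comm
  have s3 : ∑ i, ∑ j, ∑ k, (if j < i ∧ i < k then g j i k else 0) = S := Finset.sum_comm
  have s4 : ∑ i, ∑ j, ∑ k, (if j < k ∧ k < i then g j k i else 0) = S := by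
    rw [Finset.sum_comm, hS]
    exact Finset.sum_congr rfl fun i _ => Finset.sum_comm
  have s5 : ∑ i, ∑ j, ∑ k, (if k < i ∧ i < j then g k i j else 0) = S := by
    rw [Finset.sum_congr rfl fun i _ => Finset.sum_comm, Finset.sum_comm]
  have s6 : ∑ i, ∑ j, ∑ k, (if k < j ∧ j < i then g k j i else 0) = S := by
    rw [Finset.sum_congr rfl fun i _ => Finset.sum_comm, Finset.sum_comm, hS]
    exact Finset.sum_congr rfl fun i _ => Finset.sum_comm
  rw [s2, s3, s4, s5, s6]
  ring

lemma gram_trace (ψ : Trivector) : (gram (coeff ψ)).trace = ((6 * M₁ ψ : ℝ) : ℂ) := by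
  have hA := isAlt_coeff ψ
  rw [M₁, ← sum_eq_six_mul_sum_ordered]
  · simp only [trace, diag_apply, gram_apply, Complex.ofReal_sum]
    refine Finset.sum_congr rfl fun i _ => Finset.sum_congr rfl fun j _ =>
      Finset.sum_congr rfl fun k _ => ?_
    rw [Complex.star_def, Complex.mul_conj, Complex.normSq_eq_norm_sq]
  · intro i j k
    rw [hA.swap₁₂, norm_neg]
  · intro i j k
    rw [hA.swap₂₃, norm_neg]
  · intro i j
    rw [hA.self₁₂, norm_zero, zero_pow two_ne_zero]

lemma M₁_eq (ψ : Trivector) : M₁ ψ = 1 / 6 * (gram (coeff ψ)).trace.re := by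
  rw [gram_trace, Complex.ofReal_re]
  ring

lemma re_ofReal_smul_trace (r : ℝ) (A : Matrix (Fin 6) (Fin 6) ℂ) :
    ((r : ℂ) • A).trace.re = r * A.trace.re := by
  rw [trace_smul, smul_eq_mul, Complex.re_ofReal_mul]

lemma M₂_eq (ψ : Trivector) :
    M₂ ψ = 3 / 2 * (M₁ ψ ^ 2 - 1 / 12 * (gram (coeff ψ) * gram (coeff ψ)).trace.re) := by
  rw [M₂, rho1_eq, sq (_ • _), smul_mul_smul_comm]
  have : (1 / 6 * (1 / 6) : ℂ) = ((1 / 36 : ℝ) : ℂ) := by norm_num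
  rw [this, re_ofReal_smul_trace]
  ring

lemma M₃_eq (ψ : Trivector) :
    M₃ ψ = 3 * M₁ ψ * (M₁ ψ ^ 2 - M₂ ψ) -
      1 / 8 * (gram (coeff ψ) * weightedGram (coeff ψ)).trace.re := by
  rw [M₃, rho1_eq, ptraceSnd_rho12_sq, smul_mul_smul_comm]
  have : (1 / 6 * (1 / 36) : ℂ) = ((1 / 216 : ℝ) : ℂ) := by norm_num
  rw [this, re_ofReal_smul_trace]
  ring

lemma flatten_act (A : Matrix (Fin 6) (Fin 6) ℂ) (ξ : Array3) :
    flatten (act A ξ) = A * flatten ξ * (A ⊗ₖ A)ᵀ := by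
  ext i p
  simp only [flatten, of_apply, act, mul_apply, transpose_apply, kroneckerMap_apply,
    Fintype.sum_prod_type, Finset.sum_mul]
  rw [Finset.sum_comm]
  refine Eq.trans (Finset.sum_congr rfl fun b _ => Finset.sum_comm) ?_
  refine Finset.sum_congr rfl fun b _ => Finset.sum_congr rfl fun c _ =>
    Finset.sum_congr rfl fun a _ => by ring

/-- The rank of `M * Mᴴ` is that of `M`, and the flattening changes only by invertible factors on
both sides. So the rank is invariant under all of `GL(6)`, unlike the Gram matrix's traces. -/
lemma rank_gram_act {A : Matrix (Fin 6) (Fin 6) ℂ} (hA : A.det ≠ 0) (ξ : Array3) :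
    (gram (act A ξ)).rank = (gram ξ).rank := by
  have hu : IsUnit A.det := hA.isUnit
  have hk : IsUnit (A ⊗ₖ A)ᵀ.det := by
    rw [det_transpose, det_kronecker]
    exact (hu.pow _).mul (hu.pow _)
  rw [gram, gram, rank_self_mul_conjTranspose, rank_self_mul_conjTranspose, flatten_act,
    rank_mul_eq_left_of_isUnit_det _ _ hk, rank_mul_eq_right_of_isUnit_det _ _ hu]

section Unitary

variable {U : Matrix (Fin 6) (Fin 6) ℂ}

lemma gram_act (hU : U ∈ unitaryGroup (Fin 6) ℂ) (ξ : Array3) :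
    gram (act U ξ) = U * gram ξ * star U := by
  have h2 : (U ⊗ₖ U)ᵀ * (U ⊗ₖ U)ᵀᴴ = 1 := by
    rw [show (U ⊗ₖ U)ᵀᴴ = (U ⊗ₖ U)ᴴᵀ from rfl, ← transpose_mul, conjTranspose_kronecker,
      ← mul_kronecker_mul, ← star_eq_conjTranspose, mem_unitaryGroup_iff'.mp hU, one_kronecker_one,
      transpose_one]
  rw [gram, flatten_act, conjTranspose_mul, conjTranspose_mul, gram, star_eq_conjTranspose]
  simp only [Matrix.mul_assoc]
  rw [← Matrix.mul_assoc (U ⊗ₖ U)ᵀ, h2, Matrix.one_mul]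

lemma weightedGram_act (hU : U ∈ unitaryGroup (Fin 6) ℂ) (ξ : Array3) :
    weightedGram (act U ξ) = U * weightedGram ξ * star U := by
  have h1 : Uᵀ * Uᴴᵀ = 1 := by
    rw [← transpose_mul, ← star_eq_conjTranspose, mem_unitaryGroup_iff'.mp hU, transpose_one]
  -- The inner weight is itself conjugated by `U`, and the Kronecker factors from the flattenings
  -- undo this.
  have h2 : (U ⊗ₖ U)ᵀ * ((1 : Matrix (Fin 6) (Fin 6) ℂ) ⊗ₖ (gram (act U ξ))ᵀ) * (U ⊗ₖ U)ᵀᴴ =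
      (1 : Matrix (Fin 6) (Fin 6) ℂ) ⊗ₖ (gram ξ)ᵀ := by
    rw [show (U ⊗ₖ U)ᵀᴴ = (U ⊗ₖ U)ᴴᵀ from rfl, conjTranspose_kronecker, ← kroneckerMap_transpose,
      ← kroneckerMap_transpose, ← mul_kronecker_mul, ← mul_kronecker_mul, mul_one, h1, gram_act hU,
      transpose_mul, transpose_mul, star_eq_conjTranspose]
    congr 1
    rw [mul_assoc, mul_assoc, mul_assoc, h1, mul_one, ← mul_assoc, h1, one_mul]
  rw [weightedGram, flatten_act, conjTranspose_mul, conjTranspose_mul, weightedGram,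
    star_eq_conjTranspose, ← h2]
  simp only [Matrix.mul_assoc]

lemma trace_unitary_conj (hU : U ∈ unitaryGroup (Fin 6) ℂ) (A : Matrix (Fin 6) (Fin 6) ℂ) :
    (U * A * star U).trace = A.trace := by
  rw [trace_mul_comm, ← mul_assoc, mem_unitaryGroup_iff'.mp hU, one_mul]

lemma unitary_conj_mul (hU : U ∈ unitaryGroup (Fin 6) ℂ) (A B : Matrix (Fin 6) (Fin 6) ℂ) :
    U * A * star U * (U * B * star U) = U * (A * B) * star U := by
  simp only [mul_assoc]
  rw [← mul_assoc (star U), mem_unitaryGroup_iff'.mp hU, one_mul]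

lemma M₁_matMap (hU : U ∈ unitaryGroup (Fin 6) ℂ) (ψ : Trivector) : M₁ (matMap U ψ) = M₁ ψ := by
  rw [M₁_eq, M₁_eq, coeff_matMap, gram_act hU, trace_unitary_conj hU]

lemma M₂_matMap (hU : U ∈ unitaryGroup (Fin 6) ℂ) (ψ : Trivector) : M₂ (matMap U ψ) = M₂ ψ := by
  rw [M₂_eq, M₂_eq, M₁_matMap hU, coeff_matMap, gram_act hU, unitary_conj_mul hU,
    trace_unitary_conj hU]

lemma M₃_matMap (hU : U ∈ unitaryGroup (Fin 6) ℂ) (ψ : Trivector) : M₃ (matMap U ψ) = M₃ ψ := by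
  rw [M₃_eq, M₃_eq, M₁_matMap hU, M₂_matMap hU, coeff_matMap, gram_act hU, weightedGram_act hU,
    unitary_conj_mul hU, trace_unitary_conj hU]

end Unitary

end UnitaryInvariance

/-! ### The invariants of the normal form -/

/-- The normal form of a trivector under the unitary group. -/
def normalForm (d a b c z : ℂ) : Trivector :=
  d • e 1 3 5 + a • e 1 2 4 + b • e 0 3 4 + c • e 0 2 5 + z • e 0 2 4

/-- The coordinates of the normal form, one matrix for each value of the first index. -/
def normalFormSlice (d a b c z : ℂ) : Fin 6 → Matrix (Fin 6) (Fin 6) ℂ :=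
  ![!![0, 0, 0, 0, 0, 0; 0, 0, 0, 0, 0, 0; 0, 0, 0, 0, z, c; 0, 0, 0, 0, b, 0;
      0, 0, -z, -b, 0, 0; 0, 0, -c, 0, 0, 0],
    !![0, 0, 0, 0, 0, 0; 0, 0, 0, 0, 0, 0; 0, 0, 0, 0, a, 0; 0, 0, 0, 0, 0, d;
      0, 0, -a, 0, 0, 0; 0, 0, 0, -d, 0, 0],
    !![0, 0, 0, 0, -z, -c; 0, 0, 0, 0, -a, 0; 0, 0, 0, 0, 0, 0; 0, 0, 0, 0, 0, 0;
      z, a, 0, 0, 0, 0; c, 0, 0, 0, 0, 0],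
    !![0, 0, 0, 0, -b, 0; 0, 0, 0, 0, 0, -d; 0, 0, 0, 0, 0, 0; 0, 0, 0, 0, 0, 0;
      b, 0, 0, 0, 0, 0; 0, d, 0, 0, 0, 0],
    !![0, 0, z, b, 0, 0; 0, 0, a, 0, 0, 0; -z, -a, 0, 0, 0, 0; -b, 0, 0, 0, 0, 0;
      0, 0, 0, 0, 0, 0; 0, 0, 0, 0, 0, 0],
    !![0, 0, c, 0, 0, 0; 0, 0, 0, d, 0, 0; -c, 0, 0, 0, 0, 0; 0, -d, 0, 0, 0, 0;
      0, 0, 0, 0, 0, 0; 0, 0, 0, 0, 0, 0]]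

lemma coeff_normalForm (d a b c z : ℂ) (i j k : Fin 6) :
    coeff (normalForm d a b c z) i j k = normalFormSlice d a b c z i j k := by
  simp only [normalForm, coeff_add, coeff_smul, coeff_e]
  fin_cases i <;> fin_cases j <;> fin_cases k <;> simp [basisCoeff, normalFormSlice]

/-- The Gram matrix of the normal form. -/
def normalFormGram (d a b c z : ℂ) : Matrix (Fin 6) (Fin 6) ℂ :=
  !![2 * (b * star b + c * star c + z * star z), 2 * (z * star a), 0, 0, 0, 0;
    2 * (a * star z), 2 * (d * star d + a * star a), 0, 0, 0, 0;
    0, 0, 2 * (a * star a + c * star c + z * star z), 2 * (z * star b), 0, 0;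
    0, 0, 2 * (b * star z), 2 * (d * star d + b * star b), 0, 0;
    0, 0, 0, 0, 2 * (a * star a + b * star b + z * star z), 2 * (z * star c);
    0, 0, 0, 0, 2 * (c * star z), 2 * (d * star d + c * star c)]

lemma gram_normalForm (d a b c z : ℂ) :
    gram (coeff (normalForm d a b c z)) = normalFormGram d a b c z := by
  ext i i'
  simp only [gram_apply, coeff_normalForm, Fin.sum_univ_six]
  fin_cases i <;> fin_cases i' <;> simp [normalFormSlice, normalFormGram] <;> ring

lemma weightedGram_normalForm (d a b c z : ℂ) (i i' : Fin 6) :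
    weightedGram (coeff (normalForm d a b c z)) i i' = ∑ j, ∑ k',
      (∑ k, normalFormSlice d a b c z i j k * normalFormGram d a b c z k' k) *
        star (normalFormSlice d a b c z i' j k') := by
  simp only [weightedGram_apply, coeff_normalForm, gram_normalForm]

lemma M₁_normalForm (d a b c z : ℂ) : M₁ (normalForm d a b c z) =
    ‖d‖ ^ 2 + ‖a‖ ^ 2 + ‖b‖ ^ 2 + ‖c‖ ^ 2 + ‖z‖ ^ 2 := by
  have h : ((6 * M₁ (normalForm d a b c z) : ℝ) : ℂ) =
      ((6 * (‖d‖ ^ 2 + ‖a‖ ^ 2 + ‖b‖ ^ 2 + ‖c‖ ^ 2 + ‖z‖ ^ 2) : ℝ) : ℂ) := by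
    rw [← gram_trace, gram_normalForm]
    push_cast
    simp only [← Complex.mul_conj', trace, diag_apply, Fin.sum_univ_six, Complex.star_def,
      normalFormGram]
    simp
    ring
  have := Complex.ofReal_injective h
  linarith

lemma M₂_normalForm (d a b c z : ℂ) : M₂ (normalForm d a b c z) =
    2 * ‖d‖ ^ 2 * (‖a‖ ^ 2 + ‖b‖ ^ 2 + ‖c‖ ^ 2) + 3 * ‖d‖ ^ 2 * ‖z‖ ^ 2 +
      2 * (‖a‖ ^ 2 * ‖b‖ ^ 2 + ‖a‖ ^ 2 * ‖c‖ ^ 2 + ‖b‖ ^ 2 * ‖c‖ ^ 2) := by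
  have h : (gram (coeff (normalForm d a b c z)) * gram (coeff (normalForm d a b c z))).trace =
      ((12 * (‖d‖ ^ 2 + ‖a‖ ^ 2 + ‖b‖ ^ 2 + ‖c‖ ^ 2 + ‖z‖ ^ 2) ^ 2 -
        8 * (2 * ‖d‖ ^ 2 * (‖a‖ ^ 2 + ‖b‖ ^ 2 + ‖c‖ ^ 2) + 3 * ‖d‖ ^ 2 * ‖z‖ ^ 2 +
      2 * (‖a‖ ^ 2 * ‖b‖ ^ 2 + ‖a‖ ^ 2 * ‖c‖ ^ 2 + ‖b‖ ^ 2 * ‖c‖ ^ 2)) : ℝ) : ℂ) := by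
    rw [gram_normalForm]
    push_cast
    simp only [← Complex.mul_conj', trace, diag_apply, mul_apply, Fin.sum_univ_six,
      Complex.star_def, normalFormGram]
    simp
    ring
  rw [M₂_eq, M₁_normalForm, h, Complex.ofReal_re]
  ring

/-- All terms are nonnegative; for `d ≠ 0` they vanish together exactly when `z = 0` and at most one
of `a, b, c` is nonzero. -/
lemma M₁_mul_M₂_sub_normalForm (d a b c z : ℂ) :
    M₁ (normalForm d a b c z) * M₂ (normalForm d a b c z) - 2 * M₃ (normalForm d a b c z) =
      3 * ‖d‖ ^ 4 * ‖z‖ ^ 2 + 12 * ‖d‖ ^ 2 * (‖a‖ ^ 2 * ‖b‖ ^ 2 + ‖a‖ ^ 2 * ‖c‖ ^ 2 +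
        ‖b‖ ^ 2 * ‖c‖ ^ 2) + 3 * ‖d‖ ^ 2 * ‖z‖ ^ 2 * (‖a‖ ^ 2 + ‖b‖ ^ 2 + ‖c‖ ^ 2) +
        3 * ‖d * z ^ 2 + 2 * a * b * c‖ ^ 2 := by
  -- By `M₃_eq` the trace is `4(M₁M₂ - 2M₃) - 28M₁M₂ + 24M₁³`; with `|w|² = w w̄` the claim is a
  -- polynomial identity.
  have h : (gram (coeff (normalForm d a b c z)) *
        weightedGram (coeff (normalForm d a b c z))).trace =
      ((4 * (3 * ‖d‖ ^ 4 * ‖z‖ ^ 2 + 12 * ‖d‖ ^ 2 * (‖a‖ ^ 2 * ‖b‖ ^ 2 + ‖a‖ ^ 2 * ‖c‖ ^ 2 +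
        ‖b‖ ^ 2 * ‖c‖ ^ 2) + 3 * ‖d‖ ^ 2 * ‖z‖ ^ 2 * (‖a‖ ^ 2 + ‖b‖ ^ 2 + ‖c‖ ^ 2) +
        3 * ‖d * z ^ 2 + 2 * a * b * c‖ ^ 2) -
        28 * (‖d‖ ^ 2 + ‖a‖ ^ 2 + ‖b‖ ^ 2 + ‖c‖ ^ 2 + ‖z‖ ^ 2) *
        (2 * ‖d‖ ^ 2 * (‖a‖ ^ 2 + ‖b‖ ^ 2 + ‖c‖ ^ 2) + 3 * ‖d‖ ^ 2 * ‖z‖ ^ 2 +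
      2 * (‖a‖ ^ 2 * ‖b‖ ^ 2 + ‖a‖ ^ 2 * ‖c‖ ^ 2 + ‖b‖ ^ 2 * ‖c‖ ^ 2)) +
        24 * (‖d‖ ^ 2 + ‖a‖ ^ 2 + ‖b‖ ^ 2 + ‖c‖ ^ 2 + ‖z‖ ^ 2) ^ 3 : ℝ) : ℂ) := by
    rw [gram_normalForm]
    simp only [show ‖d‖ ^ 4 = ‖d‖ ^ 2 * ‖d‖ ^ 2 by ring]
    push_cast
    simp only [← Complex.mul_conj', map_add, map_mul, map_pow, map_ofNat, trace, diag_apply,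
      mul_apply, weightedGram_normalForm]
    simp only [Complex.star_def, normalFormGram, Fin.sum_univ_six, normalFormSlice, of_apply,
      cons_val, mul_zero, zero_mul, add_zero, zero_add, map_neg, map_zero]
    ring
  rw [M₃_eq, M₂_normalForm, M₁_normalForm, h, Complex.ofReal_re]
  ring

/-! ### Maximal coordinates and singular values -/

lemma isCompact_unitaryGroup :
    IsCompact {U : Matrix (Fin 6) (Fin 6) ℂ | U ∈ unitaryGroup (Fin 6) ℂ} := by
  have h : IsCompact (Set.pi Set.univ fun _ : Fin 6 => Set.pi Set.univ fun _ : Fin 6 =>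
      Metric.closedBall (0 : ℂ) 1) :=
    isCompact_univ_pi fun _ => isCompact_univ_pi fun _ => isCompact_closedBall _ _
  refine h.of_isClosed_subset ?_ ?_
  · simp only [mem_unitaryGroup_iff]
    exact isClosed_eq (by fun_prop) continuous_const
  · intro U hU i _ j _
    simpa using entry_norm_bound_of_unitary hU i j

lemma exists_unitary_maximal (ψ : Trivector) (i j k : Fin 6) :
    ∃ U ∈ unitaryGroup (Fin 6) ℂ, ∀ W ∈ unitaryGroup (Fin 6) ℂ,
      ‖coeff (matMap W ψ) i j k‖ ≤ ‖coeff (matMap U ψ) i j k‖ := by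
  have hc : Continuous fun U : Matrix (Fin 6) (Fin 6) ℂ => ‖coeff (matMap U ψ) i j k‖ := by
    simp only [coeff_matMap, act]
    fun_prop
  obtain ⟨U, hU, hmax⟩ := isCompact_unitaryGroup.exists_isMaxOn
    ⟨1, one_mem (unitaryGroup (Fin 6) ℂ)⟩ hc.continuousOn
  exact ⟨U, hU, fun W hW => hmax hW⟩

/-- The rotation in the plane of the basis vectors `p` and `q`. -/
def givens (p q : Fin 6) (α β : ℂ) : Matrix (Fin 6) (Fin 6) ℂ := of fun i =>
  if i = p then Pi.single p α + Pi.single q β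
  else if i = q then Pi.single p (-star β) + Pi.single q (star α) else Pi.single i 1

lemma givens_mem_unitaryGroup {p q : Fin 6} (hpq : p ≠ q) {α β : ℂ}
    (h : α * star α + β * star β = 1) : givens p q α β ∈ unitaryGroup (Fin 6) ℂ := by
  have hp : givens p q α β p = Pi.single p α + Pi.single q β := if_pos rfl
  have hq : givens p q α β q = Pi.single p (-star β) + Pi.single q (star α) :=
    (if_neg hpq.symm).trans (if_pos rfl)
  have hr : ∀ i, i ≠ p → i ≠ q → givens p q α β i = Pi.single i 1 := fun i h₁ h₂ =>
    (if_neg h₁).trans (if_neg h₂)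
  have h' : β * star β + α * star α = 1 := by rw [add_comm, h]
  rw [mem_unitaryGroup_iff]
  ext i j
  have hij : (givens p q α β * star (givens p q α β)) i j =
      givens p q α β i ⬝ᵥ star (givens p q α β j) := rfl
  rw [hij, one_apply]
  by_cases hip : i = p
  · rw [hip, hp]
    by_cases hjp : j = p
    · rw [hjp, hp]
      simpa [hpq, hpq.symm] using h
    · by_cases hjq : j = q
      · rw [hjq, hq]
        simp [hpq, hpq.symm]
        ring
      · rw [hr j hjp hjq]
        simp [Ne.symm hjp, Ne.symm hjq]
  · by_cases hiq : i = q
    · rw [hiq, hq]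
      by_cases hjp : j = p
      · rw [hjp, hp]
        simp [hpq, hpq.symm]
        ring
      · by_cases hjq : j = q
        · rw [hjq, hq]
          simpa [hpq, hpq.symm, mul_comm] using h'
        · rw [hr j hjp hjq]
          simp [Ne.symm hjp, Ne.symm hjq]
    · rw [hr i hip hiq]
      by_cases hjp : j = p
      · rw [hjp, hp]
        simp [hip, hiq]
      · by_cases hjq : j = q
        · rw [hjq, hq]
          simp [hip, hiq]
        · rw [hr j hjp hjq]
          simp [Pi.single_apply, eq_comm]

lemma coeff_givens {p q j k : Fin 6} (hjp : j ≠ p) (hjq : j ≠ q) (hkp : k ≠ p) (hkq : k ≠ q)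
    (α β : ℂ) (ψ : Trivector) :
    coeff (matMap (givens p q α β) ψ) p j k = α * coeff ψ p j k + β * coeff ψ q j k := by
  rw [coeff_matMap]
  simp only [act, givens, of_apply, if_pos, if_neg hjp, if_neg hjq, if_neg hkp, if_neg hkq,
    Pi.add_apply, Pi.single_apply, mul_ite, mul_one, mul_zero, ite_mul, zero_mul,
    Finset.sum_ite_eq', Finset.mem_univ, add_mul]
  simp [Finset.sum_add_distrib]

/-- By the equality case of Cauchy–Schwarz, the unit vector proportional to `(x̄, ȳ)` attains
`√(|x|² + |y|²)`, which exceeds `|x|` unless `y = 0`. -/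
lemma eq_zero_of_maximal {x y : ℂ}
    (h : ∀ α β : ℂ, α * star α + β * star β = 1 → ‖α * x + β * y‖ ≤ ‖x‖) : y = 0 := by
  by_contra hy
  set n : ℝ := Real.sqrt (‖x‖ ^ 2 + ‖y‖ ^ 2) with hn
  have hy' : 0 < ‖y‖ := norm_pos_iff.mpr hy
  have hpos : 0 < n := Real.sqrt_pos.mpr (by positivity)
  have hsq : n ^ 2 = ‖x‖ ^ 2 + ‖y‖ ^ 2 := Real.sq_sqrt (by positivity)
  have hc : (n : ℂ) ≠ 0 := Complex.ofReal_ne_zero.mpr hpos.ne'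
  have hsq' : star x * x + star y * y = (n : ℂ) ^ 2 := by
    rw [← Complex.ofReal_pow, hsq, Complex.star_def, Complex.conj_mul', Complex.conj_mul']
    push_cast
    rfl
  have key := h (star x / n) (star y / n) (by
    rw [star_div₀, star_div₀, star_star, star_star, Complex.star_def, Complex.conj_ofReal]
    field_simp
    exact hsq')
  have hval : star x / n * x + star y / n * y = n := by
    field_simp
    exact hsq'
  rw [hval, Complex.norm_real, Real.norm_of_nonneg hpos.le] at key
  nlinarith [norm_nonneg x]

lemma coeff_eq_zero_of_maximal {ψ : Trivector} {p q j k : Fin 6} (hpq : p ≠ q) (hjp : j ≠ p)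
    (hjq : j ≠ q) (hkp : k ≠ p) (hkq : k ≠ q)
    (h : ∀ W ∈ unitaryGroup (Fin 6) ℂ, ‖coeff (matMap W ψ) p j k‖ ≤ ‖coeff ψ p j k‖) :
    coeff ψ q j k = 0 := by
  refine eq_zero_of_maximal (x := coeff ψ p j k) fun α β hαβ => ?_
  rw [← coeff_givens hjp hjq hkp hkq]
  exact h _ (givens_mem_unitaryGroup hpq hαβ)

lemma exists_perm (i j k : Fin 6) (hij : i < j) (hjk : j < k) :
    ∃ σ : Equiv.Perm (Fin 6), σ 1 = i ∧ σ 3 = j ∧ σ 5 = k := by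
  revert i j k
  decide +kernel

lemma exists_unitary_coeff_ne_zero {ψ : Trivector} (hψ : ψ ≠ 0) :
    ∃ U ∈ unitaryGroup (Fin 6) ℂ, coeff (matMap U ψ) 1 3 5 ≠ 0 := by
  have h : ∃ i j k, i < j ∧ j < k ∧ coeff ψ i j k ≠ 0 := by
    by_contra! hall
    refine hψ (coeff_injective ?_)
    rw [(isAlt_coeff ψ).eq_zero hall]
    exact ((isAlt_coeff 0).eq_zero fun i j k _ _ => map_zero (coeffLinear i j k)).symm
  obtain ⟨i, j, k, hij, hjk, hne⟩ := h
  obtain ⟨σ, rfl, rfl, rfl⟩ := exists_perm i j k hij hjk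
  refine ⟨of fun a => Pi.single (σ a) 1, ?_, ?_⟩
  · rw [mem_unitaryGroup_iff]
    ext a b
    simp [mul_apply, one_apply, Pi.single_apply, eq_comm]
  · rw [coeff_matMap]
    simpa [act, Pi.single_apply] using hne

/-- For a unitary eigenbasis `W` of `Bᴴ B` the columns of `B W` are orthogonal, hence multiples of
an orthonormal basis, whose conjugates form the rows of `P`. -/
theorem exists_svd (B : Matrix (Fin 3) (Fin 3) ℂ) :
    ∃ P ∈ unitaryGroup (Fin 3) ℂ, ∃ Q ∈ unitaryGroup (Fin 3) ℂ, ∃ s, P * B * Q = diagonal s := by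
  have hH : (Bᴴ * B).IsHermitian := isHermitian_conjTranspose_mul_self B
  set W : Matrix (Fin 3) (Fin 3) ℂ := hH.eigenvectorUnitary.1 with hW
  set C := B * W with hC
  have hdiag : Cᴴ * C = diagonal (fun i => (hH.eigenvalues i : ℂ)) := by
    have h := hH.conjStarAlgAut_star_eigenvectorUnitary
    rw [Unitary.conjStarAlgAut_apply, Unitary.coe_star, star_star, ← hW, star_eq_conjTranspose] at h
    rw [hC, conjTranspose_mul, mul_assoc, ← mul_assoc Bᴴ, ← mul_assoc Wᴴ]
    exact h
  let c : Fin 3 → EuclideanSpace ℂ (Fin 3) := fun j => WithLp.toLp 2 fun i => C i j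
  have hinner : ∀ x y : EuclideanSpace ℂ (Fin 3), inner ℂ x y = ∑ i, y i * star (x i) := by
    intro x y
    rfl
  have horth : Pairwise fun i j => inner ℂ (c i) (c j) = 0 := by
    intro i j hij
    have := congrFun (congrFun hdiag i) j
    rw [diagonal_apply_ne _ hij, mul_apply] at this
    rw [hinner, ← this]
    exact Finset.sum_congr rfl fun _ _ => mul_comm _ _
  have hcard : Module.finrank ℂ (EuclideanSpace ℂ (Fin 3)) = Fintype.card (Fin 3) := by simp
  -- On orthogonal vectors Gram–Schmidt only normalizes the nonzero ones; for a zero column any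
  -- basis vector serves.
  let b := InnerProductSpace.gramSchmidtOrthonormalBasis hcard c
  have hcb : ∀ j, ∃ s : ℂ, c j = s • b j := by
    intro j
    by_cases hj : c j = 0
    · exact ⟨0, by rw [hj, zero_smul]⟩
    · refine ⟨‖c j‖, ?_⟩
      rw [InnerProductSpace.gramSchmidtOrthonormalBasis_apply_of_orthogonal hcard horth hj,
        smul_smul]
      have hne : (‖c j‖ : ℂ) ≠ 0 := Complex.ofReal_ne_zero.mpr (norm_ne_zero_iff.mpr hj)
      exact (by rw [mul_inv_cancel₀ hne, one_smul] : c j = ((‖c j‖ : ℂ) * (‖c j‖ : ℂ)⁻¹) • c j)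
  choose s hs using hcb
  refine ⟨of fun i k => star (b i k), ?_, W, hH.eigenvectorUnitary.2, s, ?_⟩
  · rw [mem_unitaryGroup_iff]
    ext i j
    have := orthonormal_iff_ite.mp b.orthonormal i j
    rw [hinner] at this
    rw [one_apply, ← this, mul_apply]
    refine Finset.sum_congr rfl fun k _ => ?_
    simp [mul_comm]
  · rw [mul_assoc, ← hC]
    ext i j
    have := orthonormal_iff_ite.mp b.orthonormal i j
    have h2 : inner ℂ (b i) (c j) = s j * if i = j then 1 else 0 := by
      rw [hs, inner_smul_right, this]
    rw [hinner] at h2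
    rw [mul_apply, diagonal_apply]
    refine Eq.trans (Finset.sum_congr rfl fun k _ => mul_comm _ _) (h2.trans ?_)
    split_ifs with h
    · rw [h, mul_one]
    · rw [mul_zero]

/-! ### Existence of the unitary normal form -/

/-- The block matrix acting by `P` on `e₀, e₂, e₄` and by `Q` on `e₁, e₃, e₅`. -/
def interleave (P Q : Matrix (Fin 3) (Fin 3) ℂ) : Matrix (Fin 6) (Fin 6) ℂ :=
  !![P 0 0, 0, P 0 1, 0, P 0 2, 0; 0, Q 0 0, 0, Q 0 1, 0, Q 0 2;
    P 1 0, 0, P 1 1, 0, P 1 2, 0; 0, Q 1 0, 0, Q 1 1, 0, Q 1 2;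
    P 2 0, 0, P 2 1, 0, P 2 2, 0; 0, Q 2 0, 0, Q 2 1, 0, Q 2 2]

lemma interleave_mem_unitaryGroup {P Q : Matrix (Fin 3) (Fin 3) ℂ}
    (hP : P ∈ unitaryGroup (Fin 3) ℂ) (hQ : Q ∈ unitaryGroup (Fin 3) ℂ) :
    interleave P Q ∈ unitaryGroup (Fin 6) ℂ := by
  have key {R : Matrix (Fin 3) (Fin 3) ℂ} (hR : R ∈ unitaryGroup (Fin 3) ℂ) (i j : Fin 3) :
      R i 0 * star (R j 0) + R i 1 * star (R j 1) + R i 2 * star (R j 2) = if i = j then 1 else 0 := by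
    have := congrFun (congrFun (mem_unitaryGroup_iff.mp hR) i) j
    rw [mul_apply, Fin.sum_univ_three, one_apply] at this
    exact this
  rw [mem_unitaryGroup_iff]
  ext i j
  rw [mul_apply, Fin.sum_univ_six]
  simp only [star_apply]
  fin_cases i <;> fin_cases j <;>
    simp [interleave, -Complex.star_def, -RCLike.star_def] <;>
    first | exact key hP _ _ | exact key hQ _ _

/-- A trivector without components having exactly one even index. -/
def semiNormalForm (d : ℂ) (B : Matrix (Fin 3) (Fin 3) ℂ) (z : ℂ) : Trivector :=
  d • e 1 3 5 + (B 0 0 • e 2 4 1 + B 0 1 • e 2 4 3 + B 0 2 • e 2 4 5) +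
    (B 1 0 • e 4 0 1 + B 1 1 • e 4 0 3 + B 1 2 • e 4 0 5) +
    (B 2 0 • e 0 2 1 + B 2 1 • e 0 2 3 + B 2 2 • e 0 2 5) + z • e 0 2 4

lemma trivector_ext {φ ψ : Trivector} (h : ∀ i j k, i < j → j < k → coeff φ i j k = coeff ψ i j k) :
    φ = ψ :=
  coeff_injective ((isAlt_coeff φ).ext (isAlt_coeff ψ) h)

lemma coeff_semiNormalForm (d : ℂ) (B : Matrix (Fin 3) (Fin 3) ℂ) (z : ℂ) (i j k : Fin 6) :
    coeff (semiNormalForm d B z) i j k = d * basisCoeff 1 3 5 i j k +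
      (B 0 0 * basisCoeff 2 4 1 i j k + B 0 1 * basisCoeff 2 4 3 i j k +
        B 0 2 * basisCoeff 2 4 5 i j k) +
      (B 1 0 * basisCoeff 4 0 1 i j k + B 1 1 * basisCoeff 4 0 3 i j k +
        B 1 2 * basisCoeff 4 0 5 i j k) +
      (B 2 0 * basisCoeff 0 2 1 i j k + B 2 1 * basisCoeff 0 2 3 i j k +
        B 2 2 * basisCoeff 0 2 5 i j k) + z * basisCoeff 0 2 4 i j k := by
  simp only [semiNormalForm, coeff_add, coeff_smul, coeff_e]

lemma forall_ordered_triple {p : Fin 6 → Fin 6 → Fin 6 → Prop} (h : p 0 1 2 ∧ p 0 1 3 ∧ p 0 1 4 ∧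
    p 0 1 5 ∧ p 0 2 3 ∧ p 0 2 4 ∧ p 0 2 5 ∧ p 0 3 4 ∧ p 0 3 5 ∧ p 0 4 5 ∧ p 1 2 3 ∧ p 1 2 4 ∧
    p 1 2 5 ∧ p 1 3 4 ∧ p 1 3 5 ∧ p 1 4 5 ∧ p 2 3 4 ∧ p 2 3 5 ∧ p 2 4 5 ∧ p 3 4 5)
    (i j k : Fin 6) (hij : i < j) (hjk : j < k) : p i j k := by
  obtain ⟨h1, h2, h3, h4, h5, h6, h7, h8, h9, h10, h11, h12, h13, h14, h15, h16, h17, h18, h19,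
    h20⟩ := h
  fin_cases i <;> fin_cases j <;> fin_cases k <;>
    first | assumption | (exfalso; revert hij hjk; decide)

lemma semiNormalForm_diagonal (d z : ℂ) (s : Fin 3 → ℂ) :
    semiNormalForm d (diagonal s) z = normalForm d (s 0) (s 1) (s 2) z := by
  refine trivector_ext (forall_ordered_triple ?_)
  simp only [coeff_semiNormalForm, coeff_normalForm]
  simp [basisCoeff, normalFormSlice]

lemma coeff_matMap_e (A : Matrix (Fin 6) (Fin 6) ℂ) (a b c i j k : Fin 6) :
    coeff (matMap A (e a b c)) i j k =
      A i a * A j b * A k c - A i a * A j c * A k b - A i b * A j a * A k c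
        + A i b * A j c * A k a + A i c * A j a * A k b - A i c * A j b * A k a := by
  rw [e, matMap_ιMulti, coeff_ιMulti]
  simp

/-- On `∧²` of the even part, in the basis `e₂₄, e₄₀, e₀₂`, `P` acts by its cofactor matrix; on the
two top powers the action is by determinants. -/
lemma matMap_interleave (P Q : Matrix (Fin 3) (Fin 3) ℂ) (d : ℂ) (B : Matrix (Fin 3) (Fin 3) ℂ)
    (z : ℂ) : matMap (interleave P Q) (semiNormalForm d B z) =
      semiNormalForm (Q.det * d) ((adjugate P)ᵀ * B * Qᵀ) (P.det * z) := by
  refine trivector_ext (forall_ordered_triple ?_)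
  simp only [coeff_semiNormalForm]
  simp only [semiNormalForm, map_add, map_smul, coeff_add, coeff_smul, coeff_matMap_e]
  refine ⟨?_, ?_, ?_, ?_, ?_, ?_, ?_, ?_, ?_, ?_, ?_, ?_, ?_, ?_, ?_, ?_, ?_, ?_, ?_, ?_⟩ <;>
    simp [interleave, basisCoeff, mul_apply, Fin.sum_univ_three, adjugate_fin_three,
      det_fin_three] <;> ring

lemma adjugate_of_mem_unitaryGroup {P : Matrix (Fin 3) (Fin 3) ℂ}
    (hP : P ∈ unitaryGroup (Fin 3) ℂ) : adjugate P = P.det • star P := by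
  have h := congrArg (· * star P) (adjugate_mul P)
  simp only [mul_assoc, mem_unitaryGroup_iff.mp hP, mul_one, smul_mul_assoc, one_mul] at h
  exact h

lemma transpose_mem_unitaryGroup {P : Matrix (Fin 3) (Fin 3) ℂ} (hP : P ∈ unitaryGroup (Fin 3) ℂ) :
    Pᵀ ∈ unitaryGroup (Fin 3) ℂ := by
  have h : Pᵀ * star Pᵀ = (star P * P)ᵀ := by
    rw [transpose_mul]
    rfl
  rw [mem_unitaryGroup_iff, h, mem_unitaryGroup_iff'.mp hP, transpose_one]

lemma exists_unitary_diagonal (d : ℂ) (B : Matrix (Fin 3) (Fin 3) ℂ) (z : ℂ) (hd : d ≠ 0) :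
    ∃ U ∈ unitaryGroup (Fin 6) ℂ, ∃ d' a b c z', d' ≠ 0 ∧
      matMap U (semiNormalForm d B z) = normalForm d' a b c z' := by
  obtain ⟨P, hP, Q, hQ, s, hs⟩ := exists_svd B
  have hP' : (star P)ᵀ ∈ unitaryGroup (Fin 3) ℂ :=
    transpose_mem_unitaryGroup (Unitary.star_mem hP)
  have hQ' : Qᵀ ∈ unitaryGroup (Fin 3) ℂ := transpose_mem_unitaryGroup hQ
  -- The cofactor matrix of the conjugate of `P` is a scalar multiple of `P`, so the block becomes
  -- that multiple of `P * B * Q`.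
  refine ⟨interleave (star P)ᵀ Qᵀ, interleave_mem_unitaryGroup hP' hQ', Qᵀ.det * d,
    (star P)ᵀ.det * s 0, (star P)ᵀ.det * s 1, (star P)ᵀ.det * s 2, (star P)ᵀ.det * z, ?_, ?_⟩
  rotate_left
  · rw [matMap_interleave, adjugate_of_mem_unitaryGroup hP']
    have : ((star P)ᵀ.det • star (star P)ᵀ)ᵀ * B * Qᵀᵀ =
        diagonal fun i => (star P)ᵀ.det * s i := by
      have h1 : star (star P)ᵀ = Pᵀ := by ext i j; simp
      rw [h1, transpose_smul, transpose_transpose, transpose_transpose, smul_mul_assoc,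
        smul_mul_assoc, hs]
      ext i j
      simp [diagonal_apply]
    rw [this, semiNormalForm_diagonal]
  · refine mul_ne_zero ?_ hd
    intro h0
    have := congrArg det (mem_unitaryGroup_iff.mp hQ')
    rw [det_mul, h0, zero_mul, det_one] at this
    exact zero_ne_one this

theorem exists_unitary_normalForm {ψ : Trivector} (hψ : ψ ≠ 0) :
    ∃ U ∈ unitaryGroup (Fin 6) ℂ, ∃ d a b c z, d ≠ 0 ∧ matMap U ψ = normalForm d a b c z := by
  obtain ⟨U, hU, hmax⟩ := exists_unitary_maximal ψ 1 3 5
  set φ := matMap U ψ with hφ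
  have hm : ∀ W ∈ unitaryGroup (Fin 6) ℂ, ‖coeff (matMap W φ) 1 3 5‖ ≤ ‖coeff φ 1 3 5‖ := by
    intro W hW
    rw [hφ, matMap_matMap]
    exact hmax _ (mul_mem hW hU)
  -- Mixing an even `q` with 1, 3 or 5 cannot increase the maximal coordinate; cyclic shifts bring
  -- the varied index to the front.
  have h1 : ∀ q, q ≠ 1 → q ≠ 3 → q ≠ 5 → coeff φ q 3 5 = 0 := fun q hq1 hq3 hq5 =>
    coeff_eq_zero_of_maximal hq1.symm (by decide) hq3.symm (by decide) hq5.symm hm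
  have h3 : ∀ q, q ≠ 1 → q ≠ 3 → q ≠ 5 → coeff φ q 5 1 = 0 := fun q hq1 hq3 hq5 =>
    coeff_eq_zero_of_maximal hq3.symm (by decide) hq5.symm (by decide) hq1.symm fun W hW => by
      rw [(isAlt_coeff _).cycle 1 3 5, (isAlt_coeff _).cycle 1 3 5]
      exact hm W hW
  have h5 : ∀ q, q ≠ 1 → q ≠ 3 → q ≠ 5 → coeff φ q 1 3 = 0 := fun q hq1 hq3 hq5 =>
    coeff_eq_zero_of_maximal hq5.symm (by decide) hq1.symm (by decide) hq3.symm fun W hW => by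
      rw [← (isAlt_coeff _).cycle 5 1 3, ← (isAlt_coeff φ).cycle 5 1 3]
      exact hm W hW
  have hd : coeff φ 1 3 5 ≠ 0 := by
    obtain ⟨W, hW, hne⟩ := exists_unitary_coeff_ne_zero hψ
    intro h0
    have := hmax W hW
    rw [h0, norm_zero] at this
    exact hne (norm_le_zero_iff.mp this)
  have hsemi : φ = semiNormalForm (coeff φ 1 3 5)
      !![coeff φ 2 4 1, coeff φ 2 4 3, coeff φ 2 4 5; coeff φ 4 0 1, coeff φ 4 0 3, coeff φ 4 0 5;
        coeff φ 0 2 1, coeff φ 0 2 3, coeff φ 0 2 5] (coeff φ 0 2 4) := by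
    have hA := isAlt_coeff φ
    refine trivector_ext (forall_ordered_triple ?_)
    simp only [coeff_semiNormalForm]
    refine ⟨?_, ?_, ?_, ?_, ?_, ?_, ?_, ?_, ?_, ?_, ?_, ?_, ?_, ?_, ?_, ?_, ?_, ?_, ?_, ?_⟩ <;>
      simp [basisCoeff]
    · exact hA.swap₂₃ 0 2 1
    · exact h5 0 (by decide) (by decide) (by decide)
    · exact hA.cycle 4 0 1
    · rw [hA.swap₂₃ 0 5 1, h3 0 (by decide) (by decide) (by decide), neg_zero]
    · exact hA.cycle 4 0 3
    · exact h1 0 (by decide) (by decide) (by decide)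
    · exact hA.swap₁₂ 4 0 5
    · rw [hA.swap₁₂ 2 1 3, h5 2 (by decide) (by decide) (by decide), neg_zero]
    · exact (hA.cycle 1 2 4).symm
    · rw [hA.swap₁₂ 2 1 5, hA.swap₂₃ 2 5 1, h3 2 (by decide) (by decide) (by decide), neg_zero,
        neg_zero]
    · rw [hA.cycle 4 1 3, h5 4 (by decide) (by decide) (by decide)]
    · rw [hA.swap₁₂ 4 1 5, hA.swap₂₃ 4 5 1, h3 4 (by decide) (by decide) (by decide), neg_zero,
        neg_zero]
    · exact hA.swap₂₃ 2 4 3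
    · exact h1 2 (by decide) (by decide) (by decide)
    · rw [hA.swap₁₂ 4 3 5, h1 4 (by decide) (by decide) (by decide), neg_zero]
  obtain ⟨W, hW, d, a, b, c, z, hd', h⟩ := exists_unitary_diagonal (coeff φ 1 3 5)
    !![coeff φ 2 4 1, coeff φ 2 4 3, coeff φ 2 4 5; coeff φ 4 0 1, coeff φ 4 0 3, coeff φ 4 0 5;
        coeff φ 0 2 1, coeff φ 0 2 3, coeff φ 0 2 5] (coeff φ 0 2 4) hd
  rw [← hsemi, hφ, matMap_matMap] at h
  exact ⟨W * U, mul_mem hW hU, d, a, b, c, z, hd', h⟩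

/-! ### The orbits of the normal form -/

/-- The block diagonal matrix acting on the planes `⟨e₀, e₁⟩`, `⟨e₂, e₃⟩`, `⟨e₄, e₅⟩`. -/
def qubitMatrix (A B C : Matrix (Fin 2) (Fin 2) ℂ) : Matrix (Fin 6) (Fin 6) ℂ :=
  !![A 0 0, A 0 1, 0, 0, 0, 0; A 1 0, A 1 1, 0, 0, 0, 0;
    0, 0, B 0 0, B 0 1, 0, 0; 0, 0, B 1 0, B 1 1, 0, 0;
    0, 0, 0, 0, C 0 0, C 0 1; 0, 0, 0, 0, C 1 0, C 1 1]

lemma det_qubitMatrix (A B C : Matrix (Fin 2) (Fin 2) ℂ) :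
    (qubitMatrix A B C).det = A.det * B.det * C.det := by
  let f : Fin 6 ≃ Fin 2 × Fin 3 :=
    ⟨![(0, 0), (1, 0), (0, 1), (1, 1), (0, 2), (1, 2)],
      fun p => ![![0, 2, 4], ![1, 3, 5]] p.1 p.2, by decide, by decide⟩
  have h : qubitMatrix A B C = (blockDiagonal ![A, B, C]).submatrix f f := by
    ext i j
    fin_cases i <;> fin_cases j <;> rfl
  rw [h, det_submatrix_equiv_self, det_blockDiagonal, Fin.prod_univ_three]
  rfl

lemma gLEquivalent_of_qubitMatrix {φ ψ : Trivector} {A B C : Matrix (Fin 2) (Fin 2) ℂ}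
    (hA : A.det ≠ 0) (hB : B.det ≠ 0) (hC : C.det ≠ 0) (h : matMap (qubitMatrix A B C) φ = ψ) :
    GLEquivalent φ ψ :=
  gLEquivalent_iff.mpr ⟨_, by rw [det_qubitMatrix]; exact mul_ne_zero (mul_ne_zero hA hB) hC, h.symm⟩

lemma isSeparable_normalForm {d : ℂ} (hd : d ≠ 0) : IsSeparable (normalForm d 0 0 0 0) := by
  refine gLEquivalent_of_qubitMatrix (A := !![1, 0; 0, d]) (B := 1) (C := 1)
    (by simpa [det_fin_two]) (by simp) (by simp) (trivector_ext (forall_ordered_triple ?_))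
  simp only [coeff_normalForm, coeff_matMap_e]
  simp [qubitMatrix, normalFormSlice]

lemma isBiseparable_normalForm {d a : ℂ} (hd : d ≠ 0) (ha : a ≠ 0) :
    IsBiseparable (normalForm d a 0 0 0) := by
  refine gLEquivalent_of_qubitMatrix (A := 1) (B := !![a, 0; 0, d]) (C := 1)
    (by simp) (by simp [det_fin_two, ha, hd]) (by simp)
    (trivector_ext (forall_ordered_triple ?_))
  simp only [coeff_normalForm, map_add, coeff_add, coeff_matMap_e]
  simp [qubitMatrix, normalFormSlice]

/-- The equations say that `p'⊗q⊗r + p⊗q'⊗r + p⊗q⊗r'` is the three-qubit tensor with entries `z, c,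
b, a, d` at 000, 001, 010, 100, 111. -/
lemma isWType_normalForm {d a b c z p₀ p₁ p₀' p₁' q₀ q₁ q₀' q₁' r₀ r₁ r₀' r₁' : ℂ}
    (hp : p₀ * p₁' - p₀' * p₁ ≠ 0) (hq : q₀ * q₁' - q₀' * q₁ ≠ 0) (hr : r₀ * r₁' - r₀' * r₁ ≠ 0)
    (h₀₀₀ : p₀' * q₀ * r₀ + p₀ * q₀' * r₀ + p₀ * q₀ * r₀' = z)
    (h₀₀₁ : p₀' * q₀ * r₁ + p₀ * q₀' * r₁ + p₀ * q₀ * r₁' = c)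
    (h₀₁₀ : p₀' * q₁ * r₀ + p₀ * q₁' * r₀ + p₀ * q₁ * r₀' = b)
    (h₀₁₁ : p₀' * q₁ * r₁ + p₀ * q₁' * r₁ + p₀ * q₁ * r₁' = 0)
    (h₁₀₀ : p₁' * q₀ * r₀ + p₁ * q₀' * r₀ + p₁ * q₀ * r₀' = a)
    (h₁₀₁ : p₁' * q₀ * r₁ + p₁ * q₀' * r₁ + p₁ * q₀ * r₁' = 0)
    (h₁₁₀ : p₁' * q₁ * r₀ + p₁ * q₁' * r₀ + p₁ * q₁ * r₀' = 0)
    (h₁₁₁ : p₁' * q₁ * r₁ + p₁ * q₁' * r₁ + p₁ * q₁ * r₁' = d) :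
    IsWType (normalForm d a b c z) := by
  refine gLEquivalent_of_qubitMatrix (A := !![p₀, p₀'; p₁, p₁']) (B := !![q₀, q₀'; q₁, q₁'])
    (C := !![r₀, r₀'; r₁, r₁']) (by rwa [det_fin_two]) (by rwa [det_fin_two])
    (by rwa [det_fin_two]) (trivector_ext (forall_ordered_triple ?_))
  simp only [coeff_normalForm, map_add, coeff_add, coeff_matMap_e]
  simp only [qubitMatrix, normalFormSlice, of_apply, cons_val, mul_zero, zero_mul, add_zero,
    sub_zero, true_and, and_true]
  exact ⟨h₀₀₀, h₀₀₁, h₀₁₀, h₀₁₁, h₁₀₀, h₁₀₁, h₁₁₀, h₁₁₁⟩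

/-- The same comparison for `p⊗q⊗r + p'⊗q'⊗r'`. -/
lemma isGHZType_normalForm {d a b c z p₀ p₁ p₀' p₁' q₀ q₁ q₀' q₁' r₀ r₁ r₀' r₁' : ℂ}
    (hp : p₀ * p₁' - p₀' * p₁ ≠ 0) (hq : q₀ * q₁' - q₀' * q₁ ≠ 0) (hr : r₀ * r₁' - r₀' * r₁ ≠ 0)
    (h₀₀₀ : p₀ * q₀ * r₀ + p₀' * q₀' * r₀' = z) (h₀₀₁ : p₀ * q₀ * r₁ + p₀' * q₀' * r₁' = c)
    (h₀₁₀ : p₀ * q₁ * r₀ + p₀' * q₁' * r₀' = b) (h₀₁₁ : p₀ * q₁ * r₁ + p₀' * q₁' * r₁' = 0)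
    (h₁₀₀ : p₁ * q₀ * r₀ + p₁' * q₀' * r₀' = a) (h₁₀₁ : p₁ * q₀ * r₁ + p₁' * q₀' * r₁' = 0)
    (h₁₁₀ : p₁ * q₁ * r₀ + p₁' * q₁' * r₀' = 0) (h₁₁₁ : p₁ * q₁ * r₁ + p₁' * q₁' * r₁' = d) :
    IsGHZType (normalForm d a b c z) := by
  refine gLEquivalent_of_qubitMatrix (A := !![p₀, p₀'; p₁, p₁']) (B := !![q₀, q₀'; q₁, q₁'])
    (C := !![r₀, r₀'; r₁, r₁']) (by rwa [det_fin_two]) (by rwa [det_fin_two])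
    (by rwa [det_fin_two]) (trivector_ext (forall_ordered_triple ?_))
  simp only [coeff_normalForm, map_add, coeff_add, coeff_matMap_e]
  simp only [qubitMatrix, normalFormSlice, of_apply, cons_val, mul_zero, zero_mul, add_zero,
    sub_zero, true_and, and_true]
  exact ⟨h₀₀₀, h₀₀₁, h₀₁₀, h₀₁₁, h₁₀₀, h₁₀₁, h₁₁₀, h₁₁₁⟩

lemma gLEquivalent_of_mul_self {A : Matrix (Fin 6) (Fin 6) ℂ} (hA : A * A = 1) {φ ψ : Trivector}
    (h : matMap A φ = ψ) : GLEquivalent φ ψ := by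
  refine gLEquivalent_iff.mpr ⟨A, fun h0 => ?_, h.symm⟩
  have := congrArg det hA
  rw [det_mul, h0, zero_mul, det_one] at this
  exact zero_ne_one this

lemma gLEquivalent_normalForm_swap₁₂ (d a b c z : ℂ) :
    GLEquivalent (normalForm d b a c z) (normalForm d a b c z) := by
  -- Exchanging two planes reverses the sign of each trivector in question; the factor -1 on `V`
  -- acts by (-1)³ and restores it.
  refine gLEquivalent_of_mul_self (A := !![0, 0, -1, 0, 0, 0; 0, 0, 0, -1, 0, 0;
    -1, 0, 0, 0, 0, 0; 0, -1, 0, 0, 0, 0; 0, 0, 0, 0, -1, 0; 0, 0, 0, 0, 0, -1]) ?_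
    (trivector_ext (forall_ordered_triple ?_))
  · ext i j
    fin_cases i <;> fin_cases j <;> simp [mul_apply, Fin.sum_univ_six, one_apply]
  · simp only [coeff_normalForm]
    simp only [normalForm, map_add, map_smul, coeff_add, coeff_smul, coeff_matMap_e]
    simp [normalFormSlice]

lemma gLEquivalent_normalForm_swap₁₃ (d a b c z : ℂ) :
    GLEquivalent (normalForm d c b a z) (normalForm d a b c z) := by
  refine gLEquivalent_of_mul_self (A := !![0, 0, 0, 0, -1, 0; 0, 0, 0, 0, 0, -1;
    0, 0, -1, 0, 0, 0; 0, 0, 0, -1, 0, 0; -1, 0, 0, 0, 0, 0; 0, -1, 0, 0, 0, 0]) ?_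
    (trivector_ext (forall_ordered_triple ?_))
  · ext i j
    fin_cases i <;> fin_cases j <;> simp [mul_apply, Fin.sum_univ_six, one_apply]
  · simp only [coeff_normalForm]
    simp only [normalForm, map_add, map_smul, coeff_add, coeff_smul, coeff_matMap_e]
    simp [normalFormSlice]

lemma exists_rank_one {x y v w : ℂ} (h : x * w = y * v) :
    ∃ q₀ q₁ r₀ r₁ : ℂ, q₀ * r₀ = x ∧ q₀ * r₁ = y ∧ q₁ * r₀ = v ∧ q₁ * r₁ = w := by
  by_cases hx : x = 0
  · by_cases hy : y = 0
    · exact ⟨0, 1, v, w, by simp [hx], by simp [hy], by simp, by simp⟩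
    · have hv : v = 0 := by simpa [hx, hy] using h
      exact ⟨y, w, 0, 1, by simp [hx], by simp, by simp [hv], by simp⟩
  · refine ⟨1, v / x, x, y, by simp, by simp, by field_simp, ?_⟩
    field_simp
    linear_combination -h

/-- The slices `X₀ = (z, c; b, 0)` and `X₁ = (a, 0; 0, d)` span a pencil that is singular at `t` and
`t'`. Both slices are combinations of the rank one matrices `R = X₀ + tX₁` and `R' = X₀ + t'X₁`: `X₁
= (R - R')/(t - t')`, `X₀ = (tR' - t'R)/(t - t')`. These coefficients are the `p`'s. -/
lemma isGHZType_normalForm_of_roots {d a b c z t t' : ℂ} (hd : d ≠ 0) (ha : a ≠ 0) (ht : t ≠ t')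
    (h : (z + t * a) * (t * d) = c * b) (h' : (z + t' * a) * (t' * d) = c * b) :
    IsGHZType (normalForm d a b c z) := by
  obtain ⟨q₀, q₁, r₀, r₁, h1, h2, h3, h4⟩ := exists_rank_one h
  obtain ⟨q₀', q₁', r₀', r₁', h1', h2', h3', h4'⟩ := exists_rank_one h'
  have hΔ : t - t' ≠ 0 := sub_ne_zero.mpr ht
  have hdet : (q₀ * q₁' - q₀' * q₁) * (r₀ * r₁' - r₀' * r₁) = - ((t - t') ^ 2 * (a * d)) := by
    have : (q₀ * q₁' - q₀' * q₁) * (r₀ * r₁' - r₀' * r₁) =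
      (q₀ * r₀) * (q₁' * r₁') - (q₀ * r₁) * (q₁' * r₀') - (q₁ * r₀) * (q₀' * r₁') +
        (q₁ * r₁) * (q₀' * r₀') := by ring
    rw [this, h1, h2, h3, h4, h1', h2', h3', h4']
    linear_combination h + h'
  have hne : (q₀ * q₁' - q₀' * q₁) * (r₀ * r₁' - r₀' * r₁) ≠ 0 := by
    rw [hdet]
    exact neg_ne_zero.mpr (mul_ne_zero (pow_ne_zero 2 hΔ) (mul_ne_zero ha hd))
  refine isGHZType_normalForm (p₀ := -t' / (t - t')) (p₁ := 1 / (t - t')) (p₀' := t / (t - t'))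
    (p₁' := -1 / (t - t')) ?_ (left_ne_zero_of_mul hne) (right_ne_zero_of_mul hne)
    ?_ ?_ ?_ ?_ ?_ ?_ ?_ ?_
  · have : -t' / (t - t') * (-1 / (t - t')) - t / (t - t') * (1 / (t - t')) = -1 / (t - t') := by
      field_simp
      ring
    rw [this]
    exact div_ne_zero (by norm_num) hΔ
  all_goals
    simp only [mul_assoc, h1, h2, h3, h4, h1', h2', h3', h4']
    field_simp
    ring

lemma isGHZType_normalForm_of_ne_zero {d a b c z : ℂ} (hd : d ≠ 0) (ha : a ≠ 0)
    (hF : d * (4 * a * b * c + d * z ^ 2) ≠ 0) : IsGHZType (normalForm d a b c z) := by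
  -- The quadratic `ad t² + zd t - bc` of the pencil has this number as its discriminant.
  obtain ⟨s, hs⟩ := IsAlgClosed.exists_pow_nat_eq (d * (4 * a * b * c + d * z ^ 2)) two_pos
  have hs0 : s ≠ 0 := by
    rintro rfl
    exact hF (by rw [← hs]; norm_num)
  refine isGHZType_normalForm_of_roots (t := (-z * d + s) / (2 * a * d))
    (t' := (-z * d - s) / (2 * a * d)) hd ha ?_ ?_ ?_
  · intro h
    field_simp at h
    apply hs0
    linear_combination h / 2
  · field_simp
    linear_combination hs
  · field_simp
    linear_combination hs

lemma isGHZType_normalForm_zero {d z : ℂ} (hd : d ≠ 0) (hz : z ≠ 0) :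
    IsGHZType (normalForm d 0 0 0 z) := by
  refine isGHZType_normalForm (p₀ := z) (p₁ := 0) (p₀' := 0) (p₁' := d) (q₀ := 1) (q₁ := 0)
    (q₀' := 0) (q₁' := 1) (r₀ := 1) (r₁ := 0) (r₀' := 0) (r₁' := 1) ?_ ?_ ?_ ?_ ?_ ?_ ?_ ?_ ?_ ?_ ?_
    <;> simp [hd, hz]

lemma isWType_normalForm_of_eq_zero {d a b c z : ℂ} (ha : a ≠ 0) (hb : b ≠ 0)
    (hc : c ≠ 0) (hz : z ≠ 0) (hF : 4 * a * b * c + d * z ^ 2 = 0) :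
    IsWType (normalForm d a b c z) := by
  -- The pencil has the double root `-z/(2a)`. There `X₀ - (z/(2a))X₁` has rank one and equals
  -- `q⊗r`; then `q', r'` solve `q'⊗r + q⊗r' = X₁`.
  refine isWType_normalForm (p₀ := z / (2 * a)) (p₁ := 1) (p₀' := 1) (p₁' := 0) (q₀ := z / 2)
    (q₁ := b) (q₀' := a / 2) (q₁' := -(a * b / z)) (r₀ := 1) (r₁ := 2 * c / z) (r₀' := a / z)
    (r₁' := -(2 * a * c / z ^ 2)) ?_ ?_ ?_ ?_ ?_ ?_ ?_ ?_ ?_ ?_ ?_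
  · simp
  · have : z / 2 * -(a * b / z) - a / 2 * b = -(a * b) := by
      field_simp
      ring
    rw [this]
    exact neg_ne_zero.mpr (mul_ne_zero ha hb)
  · have : 1 * -(2 * a * c / z ^ 2) - a / z * (2 * c / z) = -(4 * a * c / z ^ 2) := by
      field_simp
      ring
    rw [this]
    exact neg_ne_zero.mpr (div_ne_zero (mul_ne_zero (mul_ne_zero (by norm_num) ha) hc)
      (pow_ne_zero 2 hz))
  · field_simp
    ring
  · field_simp
    ring
  · field_simp
    ring
  · field_simp
    ring
  · field_simp
    ring
  · field_simp
    ring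
  · field_simp
    ring
  · field_simp
    linear_combination -hF

lemma isWType_normalForm_zero {d a b : ℂ} (hd : d ≠ 0) (ha : a ≠ 0) (hb : b ≠ 0) :
    IsWType (normalForm d a b 0 0) := by
  refine isWType_normalForm (p₀ := 0) (p₁ := 1) (p₀' := b) (p₁' := 0) (q₀ := 0) (q₁ := 1)
    (q₀' := a) (q₁' := 0) (r₀ := 1) (r₁ := 0) (r₀' := 0) (r₁' := d) ?_ ?_ ?_ ?_ ?_ ?_ ?_ ?_ ?_ ?_ ?_
    <;> simp [hd, ha, hb]

/-- The orbit of the normal form, with the values of the unitary invariants. -/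
theorem normalForm_classification {d : ℂ} (a b c z : ℂ) (hd : d ≠ 0) :
    let ψ := normalForm d a b c z
    (IsSeparable ψ ∧ M₂ ψ = 0 ∧ M₁ ψ * M₂ ψ - 2 * M₃ ψ = 0) ∨
    (IsBiseparable ψ ∧ 0 < M₂ ψ ∧ M₁ ψ * M₂ ψ - 2 * M₃ ψ = 0) ∨
    (IsWType ψ ∧ 0 < M₂ ψ ∧ 0 < M₁ ψ * M₂ ψ - 2 * M₃ ψ) ∨
    (IsGHZType ψ ∧ 0 < M₂ ψ) := by
  intro ψ
  have hdn : 0 < ‖d‖ := norm_pos_iff.mpr hd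
  have hM₂ : ∀ {a b c z : ℂ}, a ≠ 0 ∨ b ≠ 0 ∨ c ≠ 0 ∨ z ≠ 0 → 0 < M₂ (normalForm d a b c z) := by
    intro a b c z h
    rw [M₂_normalForm]
    rcases h with h | h | h | h <;> (have := norm_pos_iff.mpr h; positivity)
  have hD : ∀ {a b c z : ℂ}, (a ≠ 0 ∧ b ≠ 0) ∨ (a ≠ 0 ∧ c ≠ 0) ∨ (b ≠ 0 ∧ c ≠ 0) →
      0 < M₁ (normalForm d a b c z) * M₂ (normalForm d a b c z) -
        2 * M₃ (normalForm d a b c z) := by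
    intro a b c z h
    rw [M₁_mul_M₂_sub_normalForm]
    rcases h with ⟨h, h'⟩ | ⟨h, h'⟩ | ⟨h, h'⟩ <;>
      (have := norm_pos_iff.mpr h; have := norm_pos_iff.mpr h'; positivity)
  by_cases hF : d * (4 * a * b * c + d * z ^ 2) = 0
  · have hF' : 4 * a * b * c + d * z ^ 2 = 0 := (mul_eq_zero.mp hF).resolve_left hd
    by_cases hz : z = 0
    · subst hz
      by_cases ha : a = 0 <;> by_cases hb : b = 0 <;> by_cases hc : c = 0
      · subst ha hb hc
        exact Or.inl ⟨isSeparable_normalForm hd, by simp [ψ, M₂_normalForm],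
          by simp [ψ, M₁_mul_M₂_sub_normalForm]⟩
      · subst ha hb
        exact Or.inr <| Or.inl ⟨(isBiseparable_normalForm hd hc).trans
          (gLEquivalent_normalForm_swap₁₃ _ _ _ _ _), hM₂ (by tauto),
          by simp [ψ, M₁_mul_M₂_sub_normalForm]⟩
      · subst ha hc
        exact Or.inr <| Or.inl ⟨(isBiseparable_normalForm hd hb).trans
          (gLEquivalent_normalForm_swap₁₂ _ _ _ _ _), hM₂ (by tauto),
          by simp [ψ, M₁_mul_M₂_sub_normalForm]⟩
      · subst ha
        exact Or.inr <| Or.inr <| Or.inl ⟨(isWType_normalForm_zero hd hc hb).trans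
          (gLEquivalent_normalForm_swap₁₃ _ _ _ _ _), hM₂ (by tauto), hD (by tauto)⟩
      · subst hb hc
        exact Or.inr <| Or.inl ⟨isBiseparable_normalForm hd ha, hM₂ (by tauto),
          by simp [ψ, M₁_mul_M₂_sub_normalForm]⟩
      · subst hb
        exact Or.inr <| Or.inr <| Or.inl ⟨((isWType_normalForm_zero hd hc ha).trans
          (gLEquivalent_normalForm_swap₁₃ d 0 a c 0)).trans
          (gLEquivalent_normalForm_swap₁₂ d a 0 c 0), hM₂ (by tauto), hD (by tauto)⟩
      · subst hc
        exact Or.inr <| Or.inr <| Or.inl ⟨isWType_normalForm_zero hd ha hb, hM₂ (by tauto),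
          hD (by tauto)⟩
      · simp [ha, hb, hc] at hF'
    · have habc : a * b * c ≠ 0 := by
        intro h0
        have : d * z ^ 2 = 0 := by linear_combination hF' - 4 * h0
        exact mul_ne_zero hd (pow_ne_zero 2 hz) this
      have hc := right_ne_zero_of_mul habc
      have ha := left_ne_zero_of_mul (left_ne_zero_of_mul habc)
      have hb := right_ne_zero_of_mul (left_ne_zero_of_mul habc)
      exact Or.inr <| Or.inr <| Or.inl ⟨isWType_normalForm_of_eq_zero ha hb hc hz hF',
        hM₂ (by tauto), hD (by tauto)⟩
  · refine Or.inr <| Or.inr <| Or.inr ?_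
    -- The pencil argument needs `a ≠ 0`, so a nonzero entry among `a, b, c` is first permuted into
    -- that place; if all three vanish, then `z ≠ 0` and the form is already GHZ up to scaling.
    by_cases ha : a = 0
    · by_cases hb : b = 0
      · by_cases hc : c = 0
        · subst ha hb hc
          have hz : z ≠ 0 := by
            rintro rfl
            simp at hF
          exact ⟨isGHZType_normalForm_zero hd hz, hM₂ (by tauto)⟩
        · refine ⟨(isGHZType_normalForm_of_ne_zero hd hc ?_).trans
            (gLEquivalent_normalForm_swap₁₃ _ _ _ _ _), hM₂ (by tauto)⟩
          intro h
          exact hF (by linear_combination h)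
      · refine ⟨(isGHZType_normalForm_of_ne_zero hd hb ?_).trans
          (gLEquivalent_normalForm_swap₁₂ _ _ _ _ _), hM₂ (by tauto)⟩
        intro h
        exact hF (by linear_combination h)
    · exact ⟨isGHZType_normalForm_of_ne_zero hd ha hF, hM₂ (by tauto)⟩

/-! ### Rank of the Gram matrix and classification -/

lemma rank_gram_of_gLEquivalent {φ ψ : Trivector} (h : GLEquivalent φ ψ) :
    (gram (coeff ψ)).rank = (gram (coeff φ)).rank := by
  obtain ⟨A, hA, rfl⟩ := gLEquivalent_iff.mp h
  rw [coeff_matMap, rank_gram_act hA]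

lemma normalFormGram_zero (d a b c : ℂ) : normalFormGram d a b c 0 =
    diagonal ![2 * (b * star b + c * star c), 2 * (d * star d + a * star a),
      2 * (a * star a + c * star c), 2 * (d * star d + b * star b),
      2 * (a * star a + b * star b), 2 * (d * star d + c * star c)] := by
  ext i j
  fin_cases i <;> fin_cases j <;> simp [normalFormGram]

lemma rank_of_isSeparable {ψ : Trivector} (h : IsSeparable ψ) : (gram (coeff ψ)).rank = 3 := by
  have hN : e 1 3 5 = normalForm 1 0 0 0 0 := by simp [normalForm]
  rw [rank_gram_of_gLEquivalent h, hN, gram_normalForm, normalFormGram_zero, rank_diagonal,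
    Fintype.card_subtype, Finset.card_filter, Fin.sum_univ_six]
  simp

lemma rank_of_isBiseparable {ψ : Trivector} (h : IsBiseparable ψ) :
    (gram (coeff ψ)).rank = 5 := by
  have hN : e 1 2 4 + e 1 3 5 = normalForm 1 1 0 0 0 := by simp [normalForm, add_comm]
  rw [rank_gram_of_gLEquivalent h, hN, gram_normalForm, normalFormGram_zero, rank_diagonal,
    Fintype.card_subtype, Finset.card_filter, Fin.sum_univ_six]
  simp only [cons_val]
  norm_num

lemma rank_of_isWType {ψ : Trivector} (h : IsWType ψ) : (gram (coeff ψ)).rank = 6 := by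
  have hN : e 1 2 4 + e 0 3 4 + e 0 2 5 = normalForm 0 1 1 1 0 := by simp [normalForm]
  rw [rank_gram_of_gLEquivalent h, hN, gram_normalForm, normalFormGram_zero, rank_diagonal,
    Fintype.card_subtype, Finset.card_filter, Fin.sum_univ_six]
  simp only [cons_val]
  norm_num

theorem classification {ψ : Trivector} (hψ : ψ ≠ 0) :
    (IsSeparable ψ ∧ M₂ ψ = 0 ∧ M₁ ψ * M₂ ψ - 2 * M₃ ψ = 0) ∨
    (IsBiseparable ψ ∧ 0 < M₂ ψ ∧ M₁ ψ * M₂ ψ - 2 * M₃ ψ = 0) ∨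
    (IsWType ψ ∧ 0 < M₂ ψ ∧ 0 < M₁ ψ * M₂ ψ - 2 * M₃ ψ) ∨
    (IsGHZType ψ ∧ 0 < M₂ ψ) := by
  obtain ⟨U, hU, d, a, b, c, z, hd, hN⟩ := exists_unitary_normalForm hψ
  have h := normalForm_classification a b c z hd
  have hdet : U.det ≠ 0 := by
    intro h0
    have := congrArg det (mem_unitaryGroup_iff.mp hU)
    rw [det_mul, h0, zero_mul, det_one] at this
    exact zero_ne_one this
  have hGL : GLEquivalent (matMap U ψ) ψ := (gLEquivalent_iff.mpr ⟨U, hdet, rfl⟩).symm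
  simp only [← hN, M₁_matMap hU, M₂_matMap hU, M₃_matMap hU] at h
  rcases h with h | h | h | h
  · exact Or.inl ⟨GLEquivalent.trans h.1 hGL, h.2⟩
  · exact Or.inr <| Or.inl ⟨GLEquivalent.trans h.1 hGL, h.2⟩
  · exact Or.inr <| Or.inr <| Or.inl ⟨GLEquivalent.trans h.1 hGL, h.2⟩
  · exact Or.inr <| Or.inr <| Or.inr ⟨GLEquivalent.trans h.1 hGL, h.2⟩

lemma M₅_eq_zero_iff {ψ : Trivector} : M₅ ψ = 0 ↔ F ψ = 0 := by
  rw [M₅, sq_eq_zero_iff, norm_eq_zero]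

lemma M₅_eq_zero_of_isSeparable {ψ : Trivector} (h : IsSeparable ψ) : M₅ ψ = 0 :=
  M₅_eq_zero_iff.mpr ((F_eq_zero_iff_of_gLEquivalent h).mpr F_separable)

lemma M₅_eq_zero_of_isBiseparable {ψ : Trivector} (h : IsBiseparable ψ) : M₅ ψ = 0 :=
  M₅_eq_zero_iff.mpr ((F_eq_zero_iff_of_gLEquivalent h).mpr F_biseparable)

lemma M₅_eq_zero_of_isWType {ψ : Trivector} (h : IsWType ψ) : M₅ ψ = 0 :=
  M₅_eq_zero_iff.mpr ((F_eq_zero_iff_of_gLEquivalent h).mpr F_W)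

lemma M₅_pos_of_isGHZType {ψ : Trivector} (h : IsGHZType ψ) : 0 < M₅ ψ := by
  refine lt_of_le_of_ne (sq_nonneg _) fun h0 => ?_
  have := (F_eq_zero_iff_of_gLEquivalent h).mp (M₅_eq_zero_iff.mp h0.symm)
  rw [F_GHZ] at this
  exact one_ne_zero this

end ThreeFermion

end

theorem mainTheorem10 (ψ : ThreeFermion.Trivector) (hψ : ψ ≠ 0) :
    (ThreeFermion.IsSeparable ψ ↔ ThreeFermion.M₂ ψ = 0) ∧
    (ThreeFermion.IsBiseparable ψ ↔
      ThreeFermion.M₅ ψ = 0 ∧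
      ThreeFermion.M₁ ψ * ThreeFermion.M₂ ψ - 2 * ThreeFermion.M₃ ψ = 0 ∧
      0 < ThreeFermion.M₂ ψ) ∧
    (ThreeFermion.IsWType ψ ↔
      ThreeFermion.M₅ ψ = 0 ∧
      0 < ThreeFermion.M₁ ψ * ThreeFermion.M₂ ψ - 2 * ThreeFermion.M₃ ψ) ∧
    (ThreeFermion.IsGHZType ψ ↔ 0 < ThreeFermion.M₅ ψ) := by
  have rS := fun h => ThreeFermion.rank_of_isSeparable (ψ := ψ) h
  have rB := fun h => ThreeFermion.rank_of_isBiseparable (ψ := ψ) h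
  have rW := fun h => ThreeFermion.rank_of_isWType (ψ := ψ) h
  have fS := fun h => ThreeFermion.M₅_eq_zero_of_isSeparable (ψ := ψ) h
  have fB := fun h => ThreeFermion.M₅_eq_zero_of_isBiseparable (ψ := ψ) h
  have fW := fun h => ThreeFermion.M₅_eq_zero_of_isWType (ψ := ψ) h
  have fG := fun h => ThreeFermion.M₅_pos_of_isGHZType (ψ := ψ) h
  -- The type of `ψ` fixes the values of the invariants. Any other type is refuted by the rank, or
  -- by `M₅` when GHZ is involved; any other numerical condition is refuted by these values.
  rcases ThreeFermion.classification hψ with ⟨h, h₂, h₃⟩ | ⟨h, h₂, h₃⟩ | ⟨h, h₂, h₃⟩ | ⟨h, h₂⟩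
  · have h₅ := fS h
    have hr := rS h
    refine ⟨⟨fun _ => h₂, fun _ => h⟩, ⟨fun h' => ?_, fun h' => ?_⟩, ⟨fun h' => ?_, fun h' => ?_⟩,
      ⟨fun h' => fG h', fun h' => ?_⟩⟩
    · have := rB h'; omega
    · exact absurd h'.2.2 (by rw [h₂]; exact lt_irrefl _)
    · have := rW h'; omega
    · exact absurd h'.2 (by rw [h₃]; exact lt_irrefl _)
    · exact absurd h₅ h'.ne'
  · have h₅ := fB h
    have hr := rB h
    refine ⟨⟨fun h' => ?_, fun h' => absurd h' h₂.ne'⟩, ⟨fun _ => ⟨h₅, h₃, h₂⟩, fun _ => h⟩,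
      ⟨fun h' => ?_, fun h' => ?_⟩, ⟨fun h' => fG h', fun h' => absurd h₅ h'.ne'⟩⟩
    · have := rS h'; omega
    · have := rW h'; omega
    · exact absurd h'.2 (by rw [h₃]; exact lt_irrefl _)
  · have h₅ := fW h
    have hr := rW h
    refine ⟨⟨fun h' => ?_, fun h' => absurd h' h₂.ne'⟩,
      ⟨fun h' => ?_, fun h' => absurd h'.2.1 h₃.ne'⟩, ⟨fun _ => ⟨h₅, h₃⟩, fun _ => h⟩,
      ⟨fun h' => fG h', fun h' => absurd h₅ h'.ne'⟩⟩
    · have := rS h'; omega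
    · have := rB h'; omega
  · have h₅ := fG h
    exact ⟨⟨fun h' => absurd (fS h') h₅.ne', fun h' => absurd h' h₂.ne'⟩,
      ⟨fun h' => absurd (fB h') h₅.ne', fun h' => absurd h'.1 h₅.ne'⟩,
      ⟨fun h' => absurd (fW h') h₅.ne', fun h' => absurd h'.1 h₅.ne'⟩, ⟨fun _ => h₅, fun _ => h⟩⟩
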